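/- Let $k>2$ be an integer, $K=\lfloor k/2\rfloor$, and let $G=(V,E)$ be a finite simple undirected graph (not necessarily connected; distances between different components are infinite). $N(u)$ is the set of neighbors of $u$. A set $S\subseteq V$ is an $(a,b)$-ruling set if distinct nodes of $S$ are at distance at least $a$ and every node is at distance at most $b$ from some node of $S$. **States.** Each (anonymous) node $u$ holds $d_u\in\{0,\dots,k-1\}$, $err_u\in\{0,1\}$ and, for each $i\in\{1,\dots,K-1\}$, $c_{i,u}\in\mathbb Z/4\mathbb Z$ and $b_{i,u}\in\{\uparrow,\downarrow\}$. A configuration $C$ is the family of all local states, and $S(C)=\{u: d_u=0\}$. A *parent* (*child*) of $u$ is a $v\in N(u)$ with $d_v=d_u-1$ ($d_v=d_u+1$). **Predicates.** - $well\_defined(u)$: $err_u=0$; $|d_u-d_v|\le 1$ for all $v\in N(u)$; and if $d_u>0$ then $u$ has a parent. - $leader\_down(u)$: if $d_u=0$ then $b_{i,u}=\downarrow$ for all $i$. - $up(u,i)$: for every parent $v$, $(b_{i,u},b_{i,v},c_{i,v})\in\{(\uparrow,\uparrow,c_{i,u}),(\uparrow,\downarrow,c_{i,u}),(\uparrow,\downarrow,c_{i,u}+1),(\downarrow,\downarrow,c_{i,u})\}$.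 - $down(u,i)$: for every child $v$, $(b_{i,u},b_{i,v},c_{i,v})\in\{(\uparrow,\uparrow,c_{i,u}),(\downarrow,\uparrow,c_{i,u}),(\downarrow,\uparrow,c_{i,u}-1),(\downarrow,\downarrow,c_{i,u})\}$. - $branch\_coherence(u)$: $d_u\ge K$, or else $up(u,d_u)$ holds (void if $d_u=0$) and $up(u,i)$ and $down(u,i)$ hold for all $d_u<i\le K-1$. $C$ is *legitimate* if these three predicates hold at every node and distinct nodes of $S(C)$ are at distance at least $k$. **Rules at $u$** (guard $\Rightarrow$ command; priority number in parentheses; $i$ ranges over $\{1,\dots,K-1\}$; "such $i$" are those satisfying the condition on $i$ in the guard). - *Update distance* (0). Let $m=\min(\min\{d_v: v\in N(u)\}+1,\,k-1)$, with $\min\emptyset=\infty$. $d_u\ne0$ and $d_u\neq m$ $\Rightarrow$ $d_u:=m$; if $m<K$, choose some $v\in N(u)$ with $d_v=m-1$ and set $c_{i,u}:=c_{i,v}$, $b_{i,u}:=b_{i,v}$ for all $i\ge m$. - *Leader down* (1). $well\_defined(u)$, $d_u=0$ and $b_{i,u}=\uparrow$ for some $i$ $\Rightarrow$ $b_{i,u}:=\downarrow$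 for all $i$. - *Two heads* (1). $err_u=0$ and two distinct nodes of $N(u)\cup\{u\}$ have $d$-value $0$ $\Rightarrow$ $err_u:=1$. - *Branch incoherence* (1). $err_u=0$ and not $branch\_coherence(u)$ $\Rightarrow$ $err_u:=1$. - *Remote collision* (1). $err_u=0$, $d_u\le\frac{k-1}2$, and there are $v,v'\in N(u)\cup\{u\}$ with $1\le d_v=d_{v'}\le K-1$ and $c_{d_v,v}-c_{d_v,v'}=2$ $\Rightarrow$ $err_u:=1$. - *Incr leader* (2). $well\_defined(u)$, $d_u=0$ and for some $i$ every $v\in N(u)$ has $d_v=1$ and $c_{i,v}=c_{i,u}$ [amended version: and $b_{i,v}=\uparrow$] $\Rightarrow$ $c_{i,u}:=c_{i,u}+1$ for all such $i$. - *Sync 1 down* (2). $well\_defined(u)$ and there is exactly one $v\in N(u)$ such that for some $i$: $d_u=1$, $d_v=0$, $c_{i,u}=c_{i,v}-1$, $b_{i,u}=\uparrow$ $\Rightarrow$ $c_{i,u}:=c_{i,v}$, $b_{i,u}:=\downarrow$ for all such $i$. - *Sync 2+ down* (2). $well\_defined(u)$, $1<d_u<K$ and for some $i\ge d_u$: $b_{i,u}=\uparrow$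 and every parent $v$ has $c_{i,u}=c_{i,v}-1$, $b_{i,v}=\downarrow$ $\Rightarrow$ $c_{i,u}:=c_{i,v}$ ($v$ a parent), $b_{i,u}:=\downarrow$ for all such $i$. - *Sync 1+ up* (2). $well\_defined(u)$, $0<d_u<K$ and for some $i>d_u$: $b_{i,u}=\downarrow$ and every child $v$ has $c_{i,v}=c_{i,u}$, $b_{i,v}=\uparrow$ $\Rightarrow$ $b_{i,u}:=\uparrow$ for all such $i$. - *Sync end-of-chain* (2). $well\_defined(u)$, $0<d_u<K$ and, with $i=d_u$, every parent $v$ has $c_{i,u}=c_{i,v}-1$, $b_{i,v}=\downarrow$ [amended version: or, alternatively, $b_{i,u}=\downarrow$ and every parent $v$ has $c_{i,v}=c_{i,u}$, $b_{i,v}=\downarrow$] $\Rightarrow$ $b_{i,u}:=\uparrow$, $c_{i,u}:=c_{i,v}$ ($v$ a parent). - *Become leader* (2). $err_u=0$, $d_u=k-1$ and $d_v=k-1$ for all $v\in N(u)$ $\Rightarrow$ $d_u:=0$, $c_{i,u}:=0$, $b_{i,u}:=\downarrow$ for all $i$. - *Error spread* (2). $err_u=0$, $d_u\le K-1$ and some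 $v\in N(u)$ has $err_v=1$, $d_u<d_v$ $\Rightarrow$ $err_u:=1$. - *Reset error* (2). $err_u=1$ and ($d_u>K$, or every $v\in N(u)$ has $d_v\ge d_u$ or $err_v=1$) $\Rightarrow$ $err_u:=0$; if $d_u=0$ then $d_u:=1$; $c_{i,u}:=0$, $b_{i,u}:=\uparrow$ for all $i$. There are two versions of the algorithm, the *displayed* one (without the bracketed clauses) and the *amended* one (with both of them). **Executions.** A node is eligible for a rule if its guard holds and no rule with a smaller priority number has its guard satisfied at that node. A step $C\to C'$ consists in choosing a non-empty set of nodes, each of which executes, simultaneously and reading $C$, one rule for which it is eligible. An execution is a maximal (finite or infinite) sequence of steps from an arbitrary configuration. It is under the *Gouda daemon* if, whenever $C$ appears infinitely often in it and $C\to C'$ is a possible step, $C'$ also appears infinitely often. **Theorem.** For both versions of the algorithm, every execution under the Gouda daemon reaches a legitimate configuration. Moreover, for every legitimate configuration $C$, the set $S(C)$ is a $(k,k-1)$-ruling set of $G$. -/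

import Mathlib

namespace RulingSet

/-- `S` is an `(a,b)`-ruling set of `G`: distinct nodes of `S` are at distance at least `a`, and
every node is at distance at most `b` from some node of `S`. (`edist` is `⊤` between different
connected components.) -/
def IsRulingSet {V : Type*} (G : SimpleGraph V) (a b : ℕ) (S : Set V) : Prop :=
  (∀ u ∈ S, ∀ v ∈ S, u ≠ v → (a : ℕ∞) ≤ G.edist u v) ∧
    ∀ u, ∃ s ∈ S, G.edist u s ≤ (b : ℕ∞)

/-- The two values of the variables `b`. -/
inductive Arrow : Type
  | up
  | down

/-- The clock indices `1, …, ⌊k/2⌋ - 1`. -/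
abbrev Clock (k : ℕ) : Type := {i : ℕ // 1 ≤ i ∧ i < k / 2}

/-- The local state of a node: `d ∈ {0, …, k-1}`, `err ∈ {0,1}`, and, for every clock index `i`,
`c i ∈ ℤ/4ℤ` and `b i ∈ {↑,↓}`. -/
@[ext] structure State (k : ℕ) : Type where
  d : Fin k
  err : Bool
  c : Clock k → ZMod 4
  b : Clock k → Arrow

/-- A configuration: the local states of all the nodes. -/
abbrev Config (V : Type*) (k : ℕ) : Type _ := V → State k

section Algorithm

variable {V : Type*} {k : ℕ}

/-- The `d`-value of `u`, as a natural number. -/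
def dval (C : Config V k) (u : V) : ℕ := ((C u).d : ℕ)

/-- The set `S(C)` of the nodes with `d`-value `0`. -/
def leaders (C : Config V k) : Set V := {u | dval C u = 0}

/-- `v` is a neighbor of `u` with `d_v = d_u - 1`. -/
def Parent (G : SimpleGraph V) (C : Config V k) (u v : V) : Prop :=
  G.Adj u v ∧ dval C v + 1 = dval C u

/-- `v` is a neighbor of `u` with `d_v = d_u + 1`. -/
def Child (G : SimpleGraph V) (C : Config V k) (u v : V) : Prop :=
  G.Adj u v ∧ dval C v = dval C u + 1

/-- `v ∈ N(u) ∪ {u}`. -/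
def InClosedNbhd (G : SimpleGraph V) (u v : V) : Prop := v = u ∨ G.Adj u v

/-! ### Predicates -/

def WellDefined (G : SimpleGraph V) (C : Config V k) (u : V) : Prop :=
  (C u).err = false ∧
    (∀ v, G.Adj u v → dval C u ≤ dval C v + 1 ∧ dval C v ≤ dval C u + 1) ∧
    (0 < dval C u → ∃ v, Parent G C u v)

def LeaderDown (C : Config V k) (u : V) : Prop :=
  dval C u = 0 → ∀ i, (C u).b i = Arrow.down

def BranchCoherenceUp (G : SimpleGraph V) (C : Config V k) (u : V) (i : Clock k) : Prop :=
  ∀ v, Parent G C u v →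
    ((C u).b i, (C v).b i, (C v).c i) ∈
      ({(Arrow.up, Arrow.up, (C u).c i), (Arrow.up, Arrow.down, (C u).c i),
        (Arrow.up, Arrow.down, (C u).c i + 1), (Arrow.down, Arrow.down, (C u).c i)} :
        Set (Arrow × Arrow × ZMod 4))

def BranchCoherenceDown (G : SimpleGraph V) (C : Config V k) (u : V) (i : Clock k) : Prop :=
  ∀ v, Child G C u v →
    ((C u).b i, (C v).b i, (C v).c i) ∈
      ({(Arrow.up, Arrow.up, (C u).c i), (Arrow.down, Arrow.up, (C u).c i),
        (Arrow.down, Arrow.up, (C u).c i - 1), (Arrow.down, Arrow.down, (C u).c i)} :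
        Set (Arrow × Arrow × ZMod 4))

/-- The clause on the index `d_u` is void when `d_u = 0`: there is no clock of index `0`, and no
neighbor has `d`-value `-1`. -/
def BranchCoherence (G : SimpleGraph V) (C : Config V k) (u : V) : Prop :=
  k / 2 ≤ dval C u ∨
    ((∀ i : Clock k, i.1 = dval C u → BranchCoherenceUp G C u i) ∧
      ∀ i : Clock k, dval C u < i.1 → BranchCoherenceUp G C u i ∧ BranchCoherenceDown G C u i)

/-- Legitimate configurations. -/
def Legitimate (G : SimpleGraph V) (C : Config V k) : Prop :=
  (∀ u, WellDefined G C u ∧ LeaderDown C u ∧ BranchCoherence G C u) ∧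
    ∀ u ∈ leaders C, ∀ v ∈ leaders C, u ≠ v → (k : ℕ∞) ≤ G.edist u v

/-! ### Rules -/

/-- The two versions of the algorithm. They differ only in the guards of `incrLeader` and
`syncEndOfChain`. -/
inductive Version : Type
  /-- These guards do not look at the arrows of the neighbors of a leader, and let a node at the end
  of a chain move only if its clock is one step behind its parents. -/
  | displayed
  /-- A leader increments a clock only if the arrows of its neighbors point up, and the
  end-of-chain rule also flips the arrow of a node that is already synchronized. -/
  | amended

inductive Rule : Type
  | incrLeader
  | syncOneDown
  | syncTwoDown
  | syncUp
  | syncEndOfChain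
  | updateDistance
  | becomeLeader
  | leaderDown
  | twoHeads
  | branchIncoherence
  | remoteCollision
  | errorSpread
  | resetError

/-- Priority numbers: a smaller number takes precedence. -/
def Rule.priority : Rule → ℕ
  | .updateDistance => 0
  | .leaderDown => 1
  | .twoHeads => 1
  | .branchIncoherence => 1
  | .remoteCollision => 1
  | .incrLeader => 2
  | .syncOneDown => 2
  | .syncTwoDown => 2
  | .syncUp => 2
  | .syncEndOfChain => 2
  | .becomeLeader => 2
  | .errorSpread => 2
  | .resetError => 2

/-- `min (min {d_v | v ∈ N(u)} + 1) (k - 1)`, which is `k - 1` if `u` has no neighbor. -/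
noncomputable def newDist (G : SimpleGraph V) (C : Config V k) (u : V) : ℕ :=
  sInf (insert (k - 1) {n | ∃ v, G.Adj u v ∧ n = dval C v + 1})

/-- The indices concerned by `incrLeader`. -/
def IncrIndex (ver : Version) (G : SimpleGraph V) (C : Config V k) (u : V) (i : Clock k) : Prop :=
  ∀ v, G.Adj u v → dval C v = 1 ∧ (C u).c i - (C v).c i = 0 ∧
    (ver = Version.amended → (C v).b i = Arrow.up)

/-- The indices concerned by `syncOneDown`, with respect to the neighbor `v`. -/
def OneDownIndex (C : Config V k) (u v : V) (i : Clock k) : Prop :=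
  dval C u = 1 ∧ dval C v = 0 ∧ (C u).c i = (C v).c i - 1 ∧ (C u).b i = Arrow.up

/-- The indices concerned by `syncTwoDown`. -/
def TwoDownIndex (G : SimpleGraph V) (C : Config V k) (u : V) (i : Clock k) : Prop :=
  dval C u ≤ i.1 ∧ (C u).b i = Arrow.up ∧
    ∀ v, Parent G C u v → (C u).c i = (C v).c i - 1 ∧ (C v).b i = Arrow.down

/-- The indices concerned by `syncUp`. -/
def UpIndex (G : SimpleGraph V) (C : Config V k) (u : V) (i : Clock k) : Prop :=
  dval C u < i.1 ∧ (C u).b i = Arrow.down ∧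
    ∀ v, Child G C u v → (C u).c i = (C v).c i ∧ (C v).b i = Arrow.up

/-- The guard of a rule at the node `u` in the configuration `C`. -/
def guard (ver : Version) (G : SimpleGraph V) (C : Config V k) (u : V) : Rule → Prop
  | .incrLeader => WellDefined G C u ∧ dval C u = 0 ∧ ∃ i, IncrIndex ver G C u i
  | .syncOneDown => WellDefined G C u ∧ ∃! v, G.Adj u v ∧ ∃ i, OneDownIndex C u v i
  | .syncTwoDown =>
      WellDefined G C u ∧ 1 < dval C u ∧ dval C u < k / 2 ∧ ∃ i, TwoDownIndex G C u i
  | .syncUp => WellDefined G C u ∧ 0 < dval C u ∧ dval C u < k / 2 ∧ ∃ i, UpIndex G C u i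
  | .syncEndOfChain =>
      WellDefined G C u ∧ ∃ i : Clock k, i.1 = dval C u ∧
        ((∀ v, Parent G C u v → (C u).c i = (C v).c i - 1 ∧ (C v).b i = Arrow.down) ∨
          (ver = Version.amended ∧ (C u).b i = Arrow.down ∧
            ∀ v, Parent G C u v → (C u).c i = (C v).c i ∧ (C v).b i = Arrow.down))
  | .updateDistance => dval C u ≠ 0 ∧ dval C u ≠ newDist G C u
  | .becomeLeader =>
      (C u).err = false ∧ dval C u = k - 1 ∧ ∀ v, G.Adj u v → dval C v = k - 1
  | .leaderDown => WellDefined G C u ∧ dval C u = 0 ∧ ∃ i, (C u).b i = Arrow.up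
  | .twoHeads =>
      (C u).err = false ∧ ∃ v v', InClosedNbhd G u v ∧ InClosedNbhd G u v' ∧ v ≠ v' ∧
        dval C v = 0 ∧ dval C v' = 0
  | .branchIncoherence => (C u).err = false ∧ ¬ BranchCoherence G C u
  | .remoteCollision =>
      (C u).err = false ∧ 2 * dval C u ≤ k - 1 ∧
        ∃ v v', InClosedNbhd G u v ∧ InClosedNbhd G u v' ∧
          ∃ i : Clock k, i.1 = dval C v ∧ i.1 = dval C v' ∧ (C v).c i - (C v').c i = 2
  | .errorSpread =>
      (C u).err = false ∧ dval C u < k / 2 ∧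
        ∃ v, G.Adj u v ∧ (C v).err = true ∧ dval C u < dval C v
  | .resetError =>
      (C u).err = true ∧
        (k / 2 < dval C u ∨ ∀ v, G.Adj u v → dval C u ≤ dval C v ∨ (C v).err = true)

/-- `command G C u R s`: executing the command of the rule `R` at `u` in the configuration `C` may
give `u` the new local state `s`. Only `updateDistance` leaves a choice, that of the parent whose
clocks are copied. -/
def command (ver : Version) (G : SimpleGraph V) (C : Config V k) (u : V) :
    Rule → State k → Prop
  | .incrLeader, s =>
      s.d = (C u).d ∧ s.err = (C u).err ∧ s.b = (C u).b ∧
        ∀ i, (IncrIndex ver G C u i → s.c i = (C u).c i + 1) ∧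
          (¬ IncrIndex ver G C u i → s.c i = (C u).c i)
  | .syncOneDown, s =>
      s.d = (C u).d ∧ s.err = (C u).err ∧
        ∃ v, (G.Adj u v ∧ ∃ i, OneDownIndex C u v i) ∧
          ∀ i, (OneDownIndex C u v i → s.c i = (C v).c i ∧ s.b i = Arrow.down) ∧
            (¬ OneDownIndex C u v i → s.c i = (C u).c i ∧ s.b i = (C u).b i)
  | .syncTwoDown, s =>
      s.d = (C u).d ∧ s.err = (C u).err ∧
        ∃ v, Parent G C u v ∧
          ∀ i, (TwoDownIndex G C u i → s.c i = (C v).c i ∧ s.b i = Arrow.down) ∧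
            (¬ TwoDownIndex G C u i → s.c i = (C u).c i ∧ s.b i = (C u).b i)
  | .syncUp, s =>
      s.d = (C u).d ∧ s.err = (C u).err ∧ s.c = (C u).c ∧
        ∀ i, (UpIndex G C u i → s.b i = Arrow.up) ∧ (¬ UpIndex G C u i → s.b i = (C u).b i)
  | .syncEndOfChain, s =>
      s.d = (C u).d ∧ s.err = (C u).err ∧
        ∃ v, Parent G C u v ∧
          ∀ i : Clock k, (i.1 = dval C u → s.c i = (C v).c i ∧ s.b i = Arrow.up) ∧
            (i.1 ≠ dval C u → s.c i = (C u).c i ∧ s.b i = (C u).b i)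
  | .updateDistance, s =>
      (s.d : ℕ) = newDist G C u ∧ s.err = (C u).err ∧
        ((k / 2 ≤ newDist G C u ∧ s.c = (C u).c ∧ s.b = (C u).b) ∨
          (newDist G C u < k / 2 ∧
            ∃ v, G.Adj u v ∧ dval C v + 1 = newDist G C u ∧
              ∀ i : Clock k,
                (newDist G C u ≤ i.1 → s.c i = (C v).c i ∧ s.b i = (C v).b i) ∧
                (i.1 < newDist G C u → s.c i = (C u).c i ∧ s.b i = (C u).b i)))
  | .becomeLeader, s =>
      (s.d : ℕ) = 0 ∧ s.err = (C u).err ∧ ∀ i, s.c i = 0 ∧ s.b i = Arrow.down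
  | .leaderDown, s =>
      s.d = (C u).d ∧ s.err = (C u).err ∧ s.c = (C u).c ∧ ∀ i, s.b i = Arrow.down
  | .twoHeads, s => s.d = (C u).d ∧ s.err = true ∧ s.c = (C u).c ∧ s.b = (C u).b
  | .branchIncoherence, s => s.d = (C u).d ∧ s.err = true ∧ s.c = (C u).c ∧ s.b = (C u).b
  | .remoteCollision, s => s.d = (C u).d ∧ s.err = true ∧ s.c = (C u).c ∧ s.b = (C u).b
  | .errorSpread, s => s.d = (C u).d ∧ s.err = true ∧ s.c = (C u).c ∧ s.b = (C u).b
  | .resetError, s =>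
      (dval C u = 0 → (s.d : ℕ) = 1) ∧ (dval C u ≠ 0 → s.d = (C u).d) ∧ s.err = false ∧
        ∀ i, s.c i = 0 ∧ s.b i = Arrow.up

/-! ### Executions -/

/-- `u` is eligible for `R`: the guard of `R` holds at `u`, and no rule with a smaller priority
number has its guard satisfied at `u`. -/
def Eligible (ver : Version) (G : SimpleGraph V) (C : Config V k) (u : V) (R : Rule) : Prop :=
  guard ver G C u R ∧ ∀ R' : Rule, R'.priority < R.priority → ¬ guard ver G C u R'

/-- `C → C'`: the nodes of some non-empty set `A` simultaneously execute, each, one rule for which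
they are eligible, all reading `C`; the other nodes keep their states. -/
def Step (ver : Version) (G : SimpleGraph V) (C C' : Config V k) : Prop :=
  ∃ A : Set V, A.Nonempty ∧
    (∀ u ∈ A, ∃ R, Eligible ver G C u R ∧ command ver G C u R (C' u)) ∧
    ∀ u ∉ A, C' u = C u

/-- A maximal execution, from an arbitrary initial configuration. An execution that ends, in a
configuration from which no step is possible, is continued by repeating its last configuration. -/
def IsExecution (ver : Version) (G : SimpleGraph V) (σ : ℕ → Config V k) : Prop :=
  ∀ n, Step ver G (σ n) (σ (n + 1)) ∨
    ((∀ C', ¬ Step ver G (σ n) C') ∧ σ (n + 1) = σ n)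

/-- The Gouda daemon: if `C` appears infinitely often and `C → C'` can be executed, then `C'`
appears infinitely often. -/
def IsGouda (ver : Version) (G : SimpleGraph V) (σ : ℕ → Config V k) : Prop :=
  ∀ C C' : Config V k, Step ver G C C' →
    (∃ᶠ n in Filter.atTop, σ n = C) → ∃ᶠ n in Filter.atTop, σ n = C'

end Algorithm

end RulingSet

/-!
There are finitely many configurations, so some configuration `C` appears infinitely often in an
execution, and under the Gouda daemon so does every configuration that can be reached from `C`.
Hence it suffices to lead, by well-chosen steps, an arbitrary configuration to a legitimate one
(`exists_legitimate`).

The first half is an induction on the number of leaders (`exists_tidy`). Executing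
`updateDistance` everywhere stabilizes the distances without changing the leaders
(`exists_stable`). From then on an error at distance at most `⌊k/2⌋` from the leaders, in
particular one caused by branch incoherence, can be passed up to a leader, which resigns
(`drops_of_err`); errors farther away are simply reset. Two leaders at distance less than `k` also
allow to remove one (`Calm.drops_of_close`): if `D` is the least distance between two leaders, the
balls of radius `i = (D - 1) / 2` around two leaders at distance `D` do not interact, and the clock
`i` of the first leader can be advanced and copied through its ball as often as wanted while the
second ball rests (`exists_set_clock`). Nothing can block this: as long as the configuration is
coherent the required rules are enabled, and if it is not, a leader can be removed. When the two
clocks differ by `2`, a node in the middle raises an error. Both versions of the algorithm are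
covered, because in the displayed one a leader that increments its clock too early for a child
breaks coherence.

So a configuration is reached which is calm and coherent and whose leaders are pairwise at distance
at least `k`. If it is not legitimate, some node and all its neighbors have `d`-value `k - 1`. That
node becomes a leader and the distances are updated again (`Tidy.exists_more_leaders`). The balls
of radius `⌊k/2⌋ - 1` around the old leaders are not affected, and the nodes of the new ball copy
the clocks and arrows of the new leader, so that coherence is preserved. This can happen at most
`|V|` times.
-/

namespace RulingSet

variable {V : Type*} {k : ℕ}

/-! ### Distances -/

lemma dval_lt (C : Config V k) (u : V) : dval C u < k := (C u).d.isLt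

lemma le_newDist_iff {G : SimpleGraph V} {C : Config V k} {u : V} {n : ℕ} :
    n ≤ newDist G C u ↔ n ≤ k - 1 ∧ ∀ v, G.Adj u v → n ≤ dval C v + 1 := by
  unfold newDist
  rw [le_csInf_iff (OrderBot.bddBelow _) (Set.insert_nonempty _ _)]
  constructor
  · intro h
    exact ⟨h _ (Set.mem_insert _ _), fun v hv => h _ (Set.mem_insert_of_mem _ ⟨v, hv, rfl⟩)⟩
  · rintro ⟨h1, h2⟩ b (rfl | ⟨v, hv, rfl⟩)
    · exact h1
    · exact h2 v hv

lemma newDist_le (G : SimpleGraph V) (C : Config V k) (u : V) : newDist G C u ≤ k - 1 :=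
  (le_newDist_iff.1 le_rfl).1

lemma newDist_le_of_adj {G : SimpleGraph V} {C : Config V k} {u v : V} (h : G.Adj u v) :
    newDist G C u ≤ dval C v + 1 :=
  (le_newDist_iff.1 le_rfl).2 v h

lemma newDist_pos {G : SimpleGraph V} {C : Config V k} (hk : 2 < k) (u : V) :
    1 ≤ newDist G C u :=
  le_newDist_iff.2 ⟨by omega, fun _ _ => by omega⟩

lemma exists_adj_of_newDist_lt {G : SimpleGraph V} {C : Config V k} {u : V}
    (h : newDist G C u < k - 1) : ∃ v, G.Adj u v ∧ dval C v + 1 = newDist G C u := by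
  have hm : newDist G C u ∈ insert (k - 1) {n | ∃ v, G.Adj u v ∧ n = dval C v + 1} :=
    Nat.sInf_mem (Set.insert_nonempty _ _)
  rcases hm with h' | ⟨v, hv, h'⟩
  · omega
  · exact ⟨v, hv, h'.symm⟩

lemma newDist_congr {G : SimpleGraph V} {C C' : Config V k} (h : dval C' = dval C) :
    newDist G C' = newDist G C := by
  funext u
  unfold newDist
  rw [h]

/-- No node can execute `updateDistance`. -/
def Stable (G : SimpleGraph V) (C : Config V k) : Prop :=
  ∀ u, dval C u ≠ 0 → dval C u = newDist G C u

lemma Stable.congr {G : SimpleGraph V} {C C' : Config V k} (hC : Stable G C)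
    (h : dval C' = dval C) : Stable G C' := by
  intro u hu
  rw [newDist_congr h, h]
  rw [h] at hu
  exact hC u hu

lemma Stable.le_of_adj {G : SimpleGraph V} {C : Config V k} (hC : Stable G C) {u v : V}
    (h : G.Adj u v) : dval C u ≤ dval C v + 1 := by
  by_cases hu : dval C u = 0
  · omega
  · rw [hC u hu]
    exact newDist_le_of_adj h

lemma Stable.exists_parent {G : SimpleGraph V} {C : Config V k} (hC : Stable G C) {u : V}
    (h0 : dval C u ≠ 0) (h : dval C u < k - 1) : ∃ v, Parent G C u v := by
  have h1 := hC u h0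
  obtain ⟨v, hv, hv'⟩ := exists_adj_of_newDist_lt (G := G) (C := C) (u := u) (by omega)
  exact ⟨v, hv, by omega⟩

lemma edist_le_add_one {G : SimpleGraph V} {x u v : V} {n : ℕ} (h : G.Adj u v)
    (hn : G.edist x u ≤ (n : ℕ∞)) : G.edist x v ≤ ((n + 1 : ℕ) : ℕ∞) := by
  calc G.edist x v ≤ G.edist x u + G.edist u v := G.edist_triangle
    _ ≤ n + 1 := add_le_add hn (SimpleGraph.edist_eq_one_iff_adj.2 h).le
    _ = ((n + 1 : ℕ) : ℕ∞) := by push_cast; rfl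

lemma edist_le_add {G : SimpleGraph V} {x u v : V} {m n : ℕ}
    (hm : G.edist x u ≤ (m : ℕ∞)) (hn : G.edist u v ≤ (n : ℕ∞)) :
    G.edist x v ≤ ((m + n : ℕ) : ℕ∞) := by
  calc G.edist x v ≤ G.edist x u + G.edist u v := G.edist_triangle
    _ ≤ m + n := add_le_add hm hn
    _ = ((m + n : ℕ) : ℕ∞) := by push_cast; rfl

lemma exists_leader_of_parents {G : SimpleGraph V} {C : Config V k} :
    ∀ (n : ℕ) (u : V), dval C u = n →
      (∀ v, dval C v ≠ 0 → dval C v ≤ n → ∃ w, Parent G C v w) →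
      ∃ z, dval C z = 0 ∧ G.edist u z ≤ (n : ℕ∞) := by
  intro n
  induction n with
  | zero => exact fun u hu _ => ⟨u, hu, by simp⟩
  | succ n ih =>
    intro u hu hp
    obtain ⟨v, hv, hv'⟩ := hp u (by omega) (by omega)
    obtain ⟨z, hz, hz'⟩ := ih v (by omega) fun w h0 hw => hp w h0 (by omega)
    refine ⟨z, hz, ?_⟩
    rw [SimpleGraph.edist_comm] at hz' ⊢
    exact edist_le_add_one hv.symm hz'

lemma Stable.exists_leader {G : SimpleGraph V} {C : Config V k} (hC : Stable G C) {u : V}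
    (h : dval C u < k - 1) : ∃ z, dval C z = 0 ∧ G.edist u z ≤ (dval C u : ℕ∞) :=
  exists_leader_of_parents _ u rfl fun _ h0 hv => hC.exists_parent h0 (by omega)

lemma Stable.dval_le_length {G : SimpleGraph V} {C : Config V k} (hC : Stable G C) {u z : V}
    (p : G.Walk u z) (hz : dval C z = 0) : dval C u ≤ p.length := by
  induction p with
  | nil => omega
  | cons h q ih =>
    have := hC.le_of_adj h
    have := ih hz
    simp only [SimpleGraph.Walk.length_cons]
    omega

lemma exists_walk_length_le {G : SimpleGraph V} {u v : V} {n : ℕ} (h : G.edist u v ≤ (n : ℕ∞)) :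
    ∃ p : G.Walk u v, p.length ≤ n := by
  have hne : G.edist u v ≠ ⊤ := fun h' => by simp [h'] at h
  obtain ⟨p, hp⟩ := SimpleGraph.exists_walk_of_edist_ne_top hne
  refine ⟨p, ?_⟩
  rw [← hp] at h
  exact_mod_cast h

lemma Stable.dval_le {G : SimpleGraph V} {C : Config V k} (hC : Stable G C) {u z : V} {n : ℕ}
    (h : G.edist u z ≤ (n : ℕ∞)) (hz : dval C z = 0) : dval C u ≤ n := by
  obtain ⟨p, hp⟩ := exists_walk_length_le h
  exact (hC.dval_le_length p hz).trans hp

/-! ### Reachability -/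

section Reach

variable (ver : Version) (G : SimpleGraph V)

/-- `C'` can be reached from `C` by finitely many steps. -/
def Reaches (C C' : Config V k) : Prop := Relation.ReflTransGen (Step ver G) C C'

/-- A configuration with fewer than `n` leaders can be reached from `C`. -/
def Drops (n : ℕ) (C : Config V k) : Prop := ∃ C', Reaches ver G C C' ∧ (leaders C').ncard < n

end Reach

variable {ver : Version} {G : SimpleGraph V}

lemma Drops.of_reaches {n : ℕ} {C C' : Config V k} (h : Reaches ver G C C')
    (h' : Drops ver G n C') : Drops ver G n C :=
  let ⟨D, hD, hn⟩ := h'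
  ⟨D, Relation.ReflTransGen.trans h hD, hn⟩

lemma Step.update [DecidableEq V] {C : Config V k} {u : V} {R : Rule} {s : State k}
    (h : Eligible ver G C u R) (hs : command ver G C u R s) :
    Step ver G C (Function.update C u s) := by
  refine ⟨{u}, Set.singleton_nonempty u, ?_, ?_⟩
  · rintro v rfl
    exact ⟨R, h, by simpa using hs⟩
  · intro v hv
    exact Function.update_of_ne hv _ _

lemma dval_update [DecidableEq V] {C : Config V k} {u : V} {s : State k} (h : s.d = (C u).d) :
    dval (Function.update C u s) = dval C := by
  funext v
  by_cases hv : v = u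
  · subst hv; simp [dval, h]
  · simp [dval, hv]

/-- A round in which every node that may execute `updateDistance` does so. -/
def Round (ver : Version) (G : SimpleGraph V) (C C' : Config V k) : Prop :=
  ∀ u, (guard ver G C u .updateDistance → command ver G C u .updateDistance (C' u)) ∧
    (¬ guard ver G C u .updateDistance → C' u = C u)

lemma exists_round (hk : 2 < k) (C : Config V k) : ∃ C', Round ver G C C' := by
  classical
  have key : ∀ u, ∃ s, (guard ver G C u .updateDistance →
      command ver G C u .updateDistance s) ∧
      (¬ guard ver G C u .updateDistance → s = C u) := by
    intro u
    by_cases hg : guard ver G C u .updateDistance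
    · have hlt : newDist G C u < k := by have := newDist_le G C u; omega
      rcases lt_or_ge (newDist G C u) (k / 2) with h | h
      · obtain ⟨v, hv, hv'⟩ := exists_adj_of_newDist_lt (G := G) (C := C) (u := u) (by omega)
        refine ⟨⟨⟨newDist G C u, hlt⟩, (C u).err,
          fun i => if newDist G C u ≤ i.1 then (C v).c i else (C u).c i,
          fun i => if newDist G C u ≤ i.1 then (C v).b i else (C u).b i⟩,
          fun _ => ⟨rfl, rfl, Or.inr ⟨h, v, hv, hv', fun i => ⟨fun hi => ?_, fun hi => ?_⟩⟩⟩,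
          fun h' => absurd hg h'⟩
        · simp [hi]
        · simp [not_le.2 hi]
      · exact ⟨⟨⟨newDist G C u, hlt⟩, (C u).err, (C u).c, (C u).b⟩,
          fun _ => ⟨rfl, rfl, Or.inl ⟨h, rfl, rfl⟩⟩, fun h' => absurd hg h'⟩
    · exact ⟨C u, fun h => absurd h hg, fun _ => rfl⟩
  choose f hf using key
  exact ⟨f, hf⟩

lemma Round.reaches {C C' : Config V k} (h : Round ver G C C') : Reaches ver G C C' := by
  by_cases hne : ∃ u, guard ver G C u .updateDistance
  · refine Relation.ReflTransGen.single
      ⟨{u | guard ver G C u .updateDistance}, hne, fun u hu => ?_, fun u hu => (h u).2 hu⟩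
    exact ⟨.updateDistance, ⟨hu, fun R' hR' => absurd hR' (Nat.not_lt_zero _)⟩, (h u).1 hu⟩
  · have : C' = C := funext fun u => (h u).2 fun hu => hne ⟨u, hu⟩
    rw [this]
    exact Relation.ReflTransGen.refl

lemma Round.dval_eq_zero {C C' : Config V k} (h : Round ver G C C') {u : V} (hu : dval C u = 0) :
    dval C' u = 0 := by
  have := (h u).2 fun hg => hg.1 hu
  simpa [dval, this] using hu

lemma Round.dval_eq {C C' : Config V k} (h : Round ver G C C') {u : V} (hu : dval C u ≠ 0) :
    dval C' u = newDist G C u := by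
  by_cases hg : dval C u = newDist G C u
  · have := (h u).2 fun h' => h'.2 hg
    rw [← hg]
    simp [dval, this]
  · exact ((h u).1 ⟨hu, hg⟩).1

lemma Round.dval_eq_zero_iff (hk : 2 < k) {C C' : Config V k} (h : Round ver G C C') (u : V) :
    dval C' u = 0 ↔ dval C u = 0 := by
  refine ⟨fun h' => ?_, h.dval_eq_zero⟩
  by_contra hu
  have := newDist_pos (G := G) (C := C) hk u
  rw [h.dval_eq hu] at h'
  omega

/-- Rounds of `updateDistance` stabilize the distances. After `n` rounds the distances truncated
at `n` are final, because a distance truncated at `n + 1` is computed from the distances of the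
neighbors truncated at `n`. -/
lemma exists_stable (hk : 2 < k) (C : Config V k) :
    ∃ C', Relation.ReflTransGen (Round ver G) C C' ∧ Stable G C' := by
  choose f hf using exists_round (ver := ver) (G := G) hk
  have hreach : ∀ n, Relation.ReflTransGen (Round ver G) C (f^[n] C) := by
    intro n
    induction n with
    | zero => exact Relation.ReflTransGen.refl
    | succ n ih =>
      rw [Function.iterate_succ_apply']
      exact ih.tail (hf _)
  have htrunc : ∀ n u m, m ≤ n → (m ≤ dval (f^[n + 1] C) u ↔ m ≤ dval (f^[n] C) u) := by
    intro n
    induction n with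
    | zero => intro u m hm; simp [Nat.le_zero.1 hm]
    | succ n ih =>
      intro u m hm
      have h1 : Round ver G (f^[n] C) (f^[n + 1] C) := by
        rw [Function.iterate_succ_apply']; exact hf _
      have h2 : Round ver G (f^[n + 1] C) (f^[n + 1 + 1] C) := by
        rw [Function.iterate_succ_apply' f (n + 1)]; exact hf _
      by_cases hu : dval (f^[n] C) u = 0
      · rw [h1.dval_eq_zero hu, h2.dval_eq_zero (h1.dval_eq_zero hu)]
      · have hu' : dval (f^[n + 1] C) u ≠ 0 := fun h => hu ((h1.dval_eq_zero_iff hk u).1 h)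
        rw [h2.dval_eq hu', h1.dval_eq hu, le_newDist_iff, le_newDist_iff]
        refine and_congr_right fun _ => forall_congr' fun v => imp_congr_right fun _ => ?_
        rw [← Nat.sub_le_iff_le_add, ← Nat.sub_le_iff_le_add]
        exact ih v (m - 1) (by omega)
  refine ⟨f^[k] C, hreach k, fun u hu => ?_⟩
  have h1 : Round ver G (f^[k] C) (f^[k + 1] C) := by
    rw [Function.iterate_succ_apply']; exact hf _
  rw [← h1.dval_eq hu]
  have ha := dval_lt (f^[k] C) u
  have hb := dval_lt (f^[k + 1] C) u
  exact le_antisymm ((htrunc k u _ ha.le).2 le_rfl) ((htrunc k u _ hb.le).1 le_rfl)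

lemma reaches_of_rounds {C C' : Config V k} (h : Relation.ReflTransGen (Round ver G) C C') :
    Reaches ver G C C' := by
  induction h with
  | refl => exact Relation.ReflTransGen.refl
  | tail _ h ih => exact Relation.ReflTransGen.trans ih h.reaches

lemma leaders_of_rounds (hk : 2 < k) {C C' : Config V k}
    (h : Relation.ReflTransGen (Round ver G) C C') : leaders C' = leaders C := by
  induction h with
  | refl => rfl
  | tail _ h ih =>
    rw [← ih]
    ext u
    exact h.dval_eq_zero_iff hk u

/-! ### Errors remove leaders -/

/-- The rules of priority 1 that raise an error. -/
def Rule.IsAlarm (R : Rule) : Prop :=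
  R = .twoHeads ∨ R = .branchIncoherence ∨ R = .remoteCollision

lemma Rule.eq_of_priority_lt {R R' : Rule} (h : R'.priority < R.priority) :
    R' = .updateDistance ∨ R' = .leaderDown ∨ R'.IsAlarm := by
  have hR : R.priority ≤ 2 := by cases R <;> simp [Rule.priority]
  replace h := h.trans_le hR
  cases R' <;> simp [Rule.priority, Rule.IsAlarm] at h ⊢

lemma guard_err_of_isAlarm {C : Config V k} {u : V} {R : Rule} (hR : R.IsAlarm)
    (h : guard ver G C u R) : (C u).err = false := by
  rcases hR with rfl | rfl | rfl <;> exact h.1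

lemma Stable.not_updateDistance {C : Config V k} (hC : Stable G C) (u : V) :
    ¬ guard ver G C u .updateDistance :=
  fun h => h.2 (hC u h.1)

lemma Stable.eligible_of_priority_le_one {C : Config V k} (hC : Stable G C) {u : V} {R : Rule}
    (hR : R.priority ≤ 1) (h : guard ver G C u R) : Eligible ver G C u R := by
  refine ⟨h, fun R' hR' => ?_⟩
  have : R' = .updateDistance := by
    replace hR' := hR'.trans_le hR
    cases R' <;> simp [Rule.priority] at hR' ⊢
  rw [this]
  exact hC.not_updateDistance u

lemma Stable.step_alarm [DecidableEq V] {C : Config V k} (hC : Stable G C) {u : V} {R : Rule}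
    (hR : R.IsAlarm) (h : guard ver G C u R) :
    Step ver G C (Function.update C u { C u with err := true }) := by
  rcases hR with rfl | rfl | rfl <;>
    exact Step.update (hC.eligible_of_priority_le_one le_rfl h) ⟨rfl, rfl, rfl, rfl⟩

/-- Once the distances are stable, an error at distance at most `⌊k/2⌋` can be passed from child
to parent up to a leader, which then resigns. -/
lemma drops_of_err [Finite V] (hk : 2 < k) :
    ∀ (m : ℕ) (C : Config V k) (u : V), dval C u = m → Stable G C →
      (∀ v, (C v).err = false → LeaderDown C v) → (C u).err = true → m ≤ k / 2 →
      Drops ver G (leaders C).ncard C := by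
  classical
  intro m
  induction m with
  | zero =>
    intro C u hu hC _ he _
    have hel : Eligible ver G C u .resetError := by
      refine ⟨⟨he, Or.inr fun v _ => Or.inl (by omega)⟩, fun R hR hg => ?_⟩
      rcases Rule.eq_of_priority_lt hR with rfl | rfl | hR
      · exact hC.not_updateDistance u hg
      · have := hg.1.1
        simp [he] at this
      · have := guard_err_of_isAlarm hR hg
        simp [he] at this
    let s : State k := ⟨⟨1, by omega⟩, false, fun _ => 0, fun _ => .up⟩
    have hs : command ver G C u .resetError s :=
      ⟨fun _ => rfl, fun h => absurd hu h, rfl, fun _ => ⟨rfl, rfl⟩⟩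
    refine ⟨_, Relation.ReflTransGen.single (Step.update hel hs), Set.ncard_lt_ncard ?_⟩
    refine ⟨fun v hv => ?_, fun hsub => ?_⟩
    · by_cases hvu : v = u
      · rw [hvu]; exact hu
      · simpa [leaders, dval, hvu] using hv
    · have : dval (Function.update C u s) u = 0 := hsub (show u ∈ leaders C from hu)
      simp [dval, s] at this
  | succ m ih =>
    intro C u hu hC hdown he hm
    obtain ⟨v, hv, hv'⟩ := hC.exists_parent (u := u) (by omega) (by omega)
    have hvm : dval C v = m := by omega
    cases hev : (C v).err with
    | true => exact ih C v hvm hC hdown hev (by omega)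
    | false =>
      set C' := Function.update C v { C v with err := true } with hC'
      have hd : dval C' = dval C := dval_update rfl
      have hstep : Step ver G C C' := by
        by_cases hal : ∃ R : Rule, R.IsAlarm ∧ guard ver G C v R
        · obtain ⟨R, hR, hg⟩ := hal
          exact hC.step_alarm hR hg
        · push Not at hal
          refine Step.update (R := .errorSpread) ⟨⟨hev, by omega, u, hv.symm, he, by omega⟩,
            fun R hR hg => ?_⟩ ⟨rfl, rfl, rfl, rfl⟩
          rcases Rule.eq_of_priority_lt hR with rfl | rfl | hR
          · exact hC.not_updateDistance v hg
          · obtain ⟨-, h0, i, hi⟩ := hg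
            simp [hdown v hev h0 i] at hi
          · exact hal R hR hg
      have hdrop : Drops ver G (leaders C').ncard C' := by
        refine ih C' v (by rw [hd, hvm]) (hC.congr hd) (fun w hw => ?_) (by simp [hC']) (by omega)
        by_cases hwv : w = v
        · subst hwv
          simp [hC'] at hw
        · have hCw : C' w = C w := by simp [hC', hwv]
          intro h0 i
          rw [hCw]
          exact hdown w (hCw ▸ hw) (by rwa [hd] at h0) i
      have hl : leaders C' = leaders C := by simp only [leaders, hd]
      rw [hl] at hdrop
      exact hdrop.of_reaches (Relation.ReflTransGen.single hstep)

/-- A configuration with stable distances, without errors, and in which the arrows of the leaders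
point down. -/
structure Calm (G : SimpleGraph V) (C : Config V k) : Prop where
  stable : Stable G C
  err : ∀ u, (C u).err = false
  down : ∀ u, LeaderDown C u

lemma Calm.wellDefined {C : Config V k} (hC : Calm G C) {u : V} (hu : dval C u < k - 1) :
    WellDefined G C u :=
  ⟨hC.err u, fun _ hv => ⟨hC.stable.le_of_adj hv, hC.stable.le_of_adj hv.symm⟩,
    fun h => hC.stable.exists_parent (by omega) hu⟩

lemma Calm.drops_of_alarm [Finite V] (hk : 2 < k) {C : Config V k} (hC : Calm G C) {u : V}
    {R : Rule} (hR : R.IsAlarm) (h : guard ver G C u R) (hu : dval C u ≤ k / 2) :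
    Drops ver G (leaders C).ncard C := by
  classical
  have hd : dval (Function.update C u { C u with err := true }) = dval C := dval_update rfl
  have hl : leaders (Function.update C u { C u with err := true }) = leaders C := by
    simp only [leaders, hd]
  refine Drops.of_reaches (Relation.ReflTransGen.single (hC.stable.step_alarm hR h)) ?_
  rw [← hl]
  refine drops_of_err hk _ _ u (congrFun hd u) (hC.stable.congr hd) (fun v _ h0 i => ?_)
    (by simp) hu
  have := hC.down v (by rwa [hd] at h0) i
  by_cases hv : v = u
  · subst hv; simpa using this
  · simpa [hv] using this

lemma Calm.drops_of_not_coherent [Finite V] (hk : 2 < k) {C : Config V k} (hC : Calm G C) {u : V}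
    (h : ¬ BranchCoherence G C u) : Drops ver G (leaders C).ncard C := by
  have hu : ¬ k / 2 ≤ dval C u := fun h' => h (Or.inl h')
  exact hC.drops_of_alarm hk (R := .branchIncoherence) (Or.inr (Or.inl rfl)) ⟨hC.err u, h⟩
    (by omega)

/-- In a calm configuration, a node at distance at most `⌊k/2⌋` from the leaders can execute any
rule whose guard holds, unless a rule that raises an error takes precedence, in which case a leader
can be removed. -/
lemma Calm.drops_or_step [Finite V] [DecidableEq V] (hk : 2 < k) {C : Config V k} (hC : Calm G C)
    {u : V} (hu : dval C u ≤ k / 2) {R : Rule} {s : State k} (h : guard ver G C u R)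
    (hs : command ver G C u R s) (hsd : s.d = (C u).d) (hse : s.err = (C u).err)
    (hsb : dval C u = 0 → s.b = (C u).b) :
    Drops ver G (leaders C).ncard C ∨
      (Reaches ver G C (Function.update C u s) ∧ Calm G (Function.update C u s)) := by
  by_cases hal : ∃ R : Rule, R.IsAlarm ∧ guard ver G C u R
  · obtain ⟨R, hR, hg⟩ := hal
    exact Or.inl (hC.drops_of_alarm hk hR hg hu)
  · push Not at hal
    have hd := dval_update (C := C) (u := u) hsd
    refine Or.inr ⟨Relation.ReflTransGen.single (Step.update ⟨h, fun R' hR' hg => ?_⟩ hs),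
      hC.stable.congr hd, fun v => ?_, fun v h0 i => ?_⟩
    · rcases Rule.eq_of_priority_lt hR' with rfl | rfl | hR'
      · exact hC.stable.not_updateDistance u hg
      · obtain ⟨-, h0, i, hi⟩ := hg
        simp [hC.down u h0 i] at hi
      · exact hal R' hR' hg
    · by_cases hv : v = u
      · subst hv; simpa [hse] using hC.err v
      · simpa [hv] using hC.err v
    · rw [hd] at h0
      by_cases hv : v = u
      · subst hv; simpa [hsb h0] using hC.down v h0 i
      · simpa [hv] using hC.down v h0 i

/-- Stabilizing the distances, flipping the arrows of the leaders and resetting the errors leads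
to a calm configuration, unless a leader can be removed. -/
lemma drops_or_exists_calm [Finite V] (hk : 2 < k) (C : Config V k) :
    Drops ver G (leaders C).ncard C ∨
      ∃ C', Reaches ver G C C' ∧ leaders C' = leaders C ∧ Calm G C' := by
  classical
  obtain ⟨C₁, hr₁, hs₁⟩ := exists_stable (ver := ver) (G := G) hk C
  have hl₁ := leaders_of_rounds hk hr₁
  replace hr₁ := reaches_of_rounds hr₁
  -- All the leaders that can flip their arrows do so at once.
  let f : V → State k := fun u => if guard ver G C₁ u .leaderDown then
    { C₁ u with b := fun _ => .down } else C₁ u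
  obtain ⟨C₂, hr₂, hd₂, hdown₂⟩ : ∃ C₂, Reaches ver G C₁ C₂ ∧ dval C₂ = dval C₁ ∧
      ∀ u, (C₂ u).err = false → LeaderDown C₂ u := by
    by_cases hne : ∃ u, guard ver G C₁ u .leaderDown
    · have hdf : dval f = dval C₁ := by
        funext u
        by_cases hu : guard ver G C₁ u .leaderDown <;> simp [f, dval, hu]
      refine ⟨f, Relation.ReflTransGen.single
        ⟨{u | guard ver G C₁ u .leaderDown}, hne, fun u hu => ?_, fun u hu => if_neg hu⟩, hdf, ?_⟩
      · refine ⟨.leaderDown, hs₁.eligible_of_priority_le_one le_rfl hu, ?_⟩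
        have : f u = { C₁ u with b := fun _ => .down } := if_pos hu
        rw [this]
        exact ⟨rfl, rfl, rfl, fun _ => rfl⟩
      · intro u he h0 i
        by_cases hu : guard ver G C₁ u .leaderDown
        · have : f u = { C₁ u with b := fun _ => .down } := if_pos hu
          rw [this]
        · have hfu : f u = C₁ u := if_neg hu
          rw [hdf] at h0
          rw [hfu] at he ⊢
          by_contra hb
          refine hu ⟨⟨he, fun v hv => ⟨by omega, hs₁.le_of_adj hv.symm⟩, fun h => by omega⟩, h0, i,
            ?_⟩
          cases hbi : (C₁ u).b i with
          | up => rfl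
          | down => exact absurd hbi hb
    · refine ⟨C₁, Relation.ReflTransGen.refl, rfl, fun u he h0 i => ?_⟩
      by_contra hb
      refine hne ⟨u, ⟨he, fun v hv => ⟨by omega, hs₁.le_of_adj hv.symm⟩, fun h => by omega⟩, h0, i,
        ?_⟩
      cases hbi : (C₁ u).b i with
      | up => rfl
      | down => exact absurd hbi hb
  have hs₂ := hs₁.congr hd₂
  have hl₂ : leaders C₂ = leaders C := by
    rw [← hl₁]; simp only [leaders, hd₂]
  replace hr₂ : Reaches ver G C C₂ := Relation.ReflTransGen.trans hr₁ hr₂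
  by_cases hlow : ∃ u, (C₂ u).err = true ∧ dval C₂ u ≤ k / 2
  · obtain ⟨u, he, hu⟩ := hlow
    left
    rw [← hl₂]
    exact (drops_of_err hk _ C₂ u rfl hs₂ hdown₂ he hu).of_reaches hr₂
  · push Not at hlow
    right
    -- The remaining errors are far from the leaders: they are reset at once, which changes no
    -- `d`-value.
    let g : V → State k := fun u => if (C₂ u).err = true then
      ⟨(C₂ u).d, false, fun _ => 0, fun _ => .up⟩ else C₂ u
    have hdg : dval g = dval C₂ := by
      funext u
      by_cases hu : (C₂ u).err = true <;> simp [g, dval, hu]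
    have hg : Calm G g := by
      refine ⟨hs₂.congr hdg, fun u => ?_, fun u h0 i => ?_⟩
      · by_cases hu : (C₂ u).err = true <;> simp [g, hu]
      · rw [hdg] at h0
        have hu : (C₂ u).err = false := by
          by_contra hu
          have := hlow u (by simpa using hu)
          omega
        have hgu : g u = C₂ u := if_neg (by simp [hu])
        rw [hgu]
        exact hdown₂ u hu h0 i
    by_cases hne : ∃ u, (C₂ u).err = true
    · refine ⟨g, Relation.ReflTransGen.tail hr₂
        ⟨{u | (C₂ u).err = true}, hne, fun u hu => ?_, fun u hu => if_neg hu⟩, ?_, hg⟩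
      · have hgu : g u = ⟨(C₂ u).d, false, fun _ => 0, fun _ => .up⟩ := if_pos hu
        have hK := hlow u hu
        refine ⟨.resetError, ⟨⟨hu, Or.inl hK⟩, fun R hR hg => ?_⟩, ?_⟩
        · have hu' : (C₂ u).err ≠ false := by simp [show (C₂ u).err = true from hu]
          rcases Rule.eq_of_priority_lt hR with rfl | rfl | hR
          · exact hs₂.not_updateDistance u hg
          · exact hu' hg.1.1
          · exact hu' (guard_err_of_isAlarm hR hg)
        · rw [hgu]
          exact ⟨fun h => by omega, fun _ => rfl, rfl, fun _ => ⟨rfl, rfl⟩⟩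
      · rw [← hl₂]; simp only [leaders, hdg]
    · push Not at hne
      have : g = C₂ := funext fun u => if_neg (hne u)
      rw [this] at hg
      exact ⟨C₂, hr₂, hl₂, hg⟩

/-! ### The ball of an isolated leader -/

/-- The node `x` is a leader, and the other leaders are at distance more than `2 * r` from it. The
configuration enters only through its `d`-values `δ`. -/
structure Isolated (G : SimpleGraph V) (δ : V → ℕ) (x : V) (r : ℕ) : Prop where
  leader : δ x = 0
  sep : ∀ z, δ z = 0 → z ≠ x → ((2 * r + 1 : ℕ) : ℕ∞) ≤ G.edist x z

/-- The nodes whose `d`-value is at most `r` and is realized by the leader `x`. -/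
def Ball (G : SimpleGraph V) (δ : V → ℕ) (x : V) (r : ℕ) : Set V :=
  {u | δ u ≤ r ∧ G.edist x u ≤ (δ u : ℕ∞)}

lemma Isolated.eq {δ : V → ℕ} {x z : V} {r n : ℕ} (hx : Isolated G δ x r) (hz : δ z = 0)
    (h : G.edist x z ≤ (n : ℕ∞)) (hn : n ≤ 2 * r) : z = x := by
  by_contra hne
  have := (hx.sep z hz hne).trans h
  have : 2 * r + 1 ≤ n := by exact_mod_cast this
  omega

lemma Isolated.mem_ball {δ : V → ℕ} {x : V} {r : ℕ} (hx : Isolated G δ x r) :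
    x ∈ Ball G δ x r := by
  simp [Ball, hx.leader]

lemma eq_of_mem_ball {δ : V → ℕ} {x u : V} {r : ℕ} (hu : u ∈ Ball G δ x r) (h0 : δ u = 0) :
    u = x := by
  have := hu.2
  rw [h0] at this
  exact (SimpleGraph.edist_eq_zero_iff.1 (nonpos_iff_eq_zero.1 (by exact_mod_cast this))).symm

lemma Isolated.parent_mem_ball {C : Config V k} {x u v : V} {r : ℕ}
    (hx : Isolated G (dval C) x r) (hC : Stable G C) (hu : u ∈ Ball G (dval C) x r)
    (hr : r < k / 2) (hv : Parent G C u v) : v ∈ Ball G (dval C) x r := by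
  obtain ⟨hadj, hd⟩ := hv
  obtain ⟨hur, hxu⟩ := hu
  obtain ⟨z, hz, hvz⟩ := hC.exists_leader (u := v) (by omega)
  have hxv := edist_le_add_one hadj hxu
  have hzx : z = x := hx.eq hz (edist_le_add hxv hvz) (by omega)
  refine ⟨by omega, ?_⟩
  rw [SimpleGraph.edist_comm, ← hzx]
  exact hvz

lemma child_mem_ball {C : Config V k} {x u v : V} {r : ℕ} (hu : u ∈ Ball G (dval C) x r)
    (hr : dval C u < r) (hv : Child G C u v) : v ∈ Ball G (dval C) x r := by
  obtain ⟨hadj, hd⟩ := hv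
  refine ⟨by omega, ?_⟩
  rw [hd]
  exact edist_le_add_one hadj hu.2

lemma Isolated.dval_of_adj {C : Config V k} {x v : V} {r : ℕ}
    (hx : Isolated G (dval C) x r) (hC : Stable G C) (hr : 1 ≤ r) (hv : G.Adj x v) :
    dval C v = 1 := by
  have h1 := hC.le_of_adj hv.symm
  rw [hx.leader] at h1
  by_contra hne
  refine hv.ne' (hx.eq (n := 1) (by omega) ?_ (by omega))
  exact_mod_cast (SimpleGraph.edist_eq_one_iff_adj.2 hv).le

/-- The configuration `C'` is calm and reachable from `C` without changing any `d`-value, nor the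
states of the nodes outside of `B`. -/
structure Evolves (ver : Version) (G : SimpleGraph V) (B : Set V) (C C' : Config V k) : Prop where
  reaches : Reaches ver G C C'
  calm : Calm G C'
  dval_eq : dval C' = dval C
  outside : ∀ u, u ∉ B → C' u = C u

lemma Evolves.refl {B : Set V} {C : Config V k} (hC : Calm G C) : Evolves ver G B C C :=
  ⟨Relation.ReflTransGen.refl, hC, rfl, fun _ _ => rfl⟩

lemma Evolves.trans {B : Set V} {C C' C'' : Config V k} (h : Evolves ver G B C C')
    (h' : Evolves ver G B C' C'') : Evolves ver G B C C'' :=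
  ⟨Relation.ReflTransGen.trans h.reaches h'.reaches, h'.calm, h'.dval_eq.trans h.dval_eq,
    fun u hu => (h'.outside u hu).trans (h.outside u hu)⟩

lemma Evolves.drops {B : Set V} {C C' : Config V k} (h : Evolves ver G B C C')
    (h' : Drops ver G (leaders C').ncard C') : Drops ver G (leaders C).ncard C := by
  have hl : leaders C' = leaders C := by simp only [leaders, h.dval_eq]
  rw [← hl]
  exact h'.of_reaches h.reaches

lemma Calm.drops_or_evolves [Finite V] [DecidableEq V] (hk : 2 < k) {C : Config V k}
    (hC : Calm G C) {B : Set V} {u : V} (hB : u ∈ B) (hu : dval C u ≤ k / 2) {R : Rule}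
    {s : State k} (h : guard ver G C u R) (hs : command ver G C u R s) (hsd : s.d = (C u).d)
    (hse : s.err = (C u).err) (hsb : dval C u = 0 → s.b = (C u).b) :
    Drops ver G (leaders C).ncard C ∨ Evolves ver G B C (Function.update C u s) := by
  refine (hC.drops_or_step hk hu h hs hsd hse hsb).imp_right fun ⟨h1, h2⟩ => ⟨h1, h2,
    dval_update hsd, fun v hv => Function.update_of_ne ?_ _ _⟩
  rintro rfl
  exact hv hB

/-! ### Clock waves -/

/-- Branch coherence along an edge: a child has the same clock as its parent, except that a child
with arrow up may be one step behind a parent with arrow down; and the parent of a node with arrow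
down has its arrow down. -/
lemma BranchCoherence.parent {C : Config V k} {u v : V} {i : Clock k} (h : BranchCoherence G C u)
    (hi : dval C u ≤ i.1) (hv : Parent G C u v) :
    ((C v).c i = (C u).c i ∧ ((C u).b i = .down → (C v).b i = .down)) ∨
      ((C u).b i = .up ∧ (C v).b i = .down ∧ (C v).c i = (C u).c i + 1) := by
  have hup : BranchCoherenceUp G C u i := by
    rcases h with h | ⟨h1, h2⟩
    · have := i.2.2
      omega
    · rcases hi.eq_or_lt with h' | h'
      · exact h1 i h'.symm
      · exact (h2 i h').1
  have := hup v hv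
  simp only [Set.mem_insert_iff, Set.mem_singleton_iff, Prod.mk.injEq] at this
  rcases this with ⟨h1, h2, h3⟩ | ⟨h1, h2, h3⟩ | ⟨h1, h2, h3⟩ | ⟨h1, h2, h3⟩ <;> simp [h1, h2, h3]

/-- A node of a coherent configuration whose clock disagrees with the common clock of its parents
can synchronize with them. -/
lemma exists_sync_down {C : Config V k} (hC : Calm G C) {u : V} {i : Clock k} {a : ZMod 4}
    (h0 : dval C u ≠ 0) (hi : dval C u ≤ i.1) (hcoh : BranchCoherence G C u)
    (hne : (C u).c i ≠ a) (hpar : ∀ v, Parent G C u v → (C v).c i = a)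
    (huniq : dval C u = 1 → ∀ v w, Parent G C u v → Parent G C u w → v = w) :
    ∃ R s, guard ver G C u R ∧ command ver G C u R s ∧ s.d = (C u).d ∧ s.err = (C u).err ∧
      s.c i = a := by
  classical
  have hik := i.2.2
  have hwd : WellDefined G C u := hC.wellDefined (by omega)
  obtain ⟨v, hv⟩ := hwd.2.2 (by omega)
  -- By coherence, `u` is one step behind each of its parents.
  have hbehind : ∀ w, Parent G C u w →
      (C u).b i = .up ∧ (C w).b i = .down ∧ (C u).c i = (C w).c i - 1 := by
    intro w hw
    rcases hcoh.parent hi hw with ⟨h, -⟩ | ⟨h1, h2, h3⟩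
    · exact absurd (h.symm.trans (hpar w hw)) hne
    · exact ⟨h1, h2, by rw [h3]; ring⟩
  by_cases hend : i.1 = dval C u
  · refine ⟨.syncEndOfChain, ⟨(C u).d, (C u).err,
      fun j => if j.1 = dval C u then (C v).c j else (C u).c j,
      fun j => if j.1 = dval C u then .up else (C u).b j⟩,
      ⟨hwd, i, hend, Or.inl fun w hw => ⟨(hbehind w hw).2.2, (hbehind w hw).2.1⟩⟩,
      ⟨rfl, rfl, v, hv, fun j => ⟨fun hj => ?_, fun hj => ?_⟩⟩, rfl, rfl, ?_⟩
    · simp [hj]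
    · simp [hj]
    · simp [hend, hpar v hv]
  · by_cases h1 : dval C u = 1
    · have hpv : ∀ w, G.Adj u w ∧ (∃ j, OneDownIndex C u w j) → Parent G C u w := by
        rintro w ⟨hw, j, hj⟩
        exact ⟨hw, by rw [hj.1, hj.2.1]⟩
      have hidx : OneDownIndex C u v i :=
        ⟨h1, by have := hv.2; omega, (hbehind v hv).2.2, (hbehind v hv).1⟩
      refine ⟨.syncOneDown, ⟨(C u).d, (C u).err,
        fun j => if OneDownIndex C u v j then (C v).c j else (C u).c j,
        fun j => if OneDownIndex C u v j then .down else (C u).b j⟩,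
        ⟨hwd, v, ⟨hv.1, i, hidx⟩, fun w hw => huniq h1 w v (hpv w hw) hv⟩,
        ⟨rfl, rfl, v, ⟨hv.1, i, hidx⟩, fun j => ⟨fun hj => ?_, fun hj => ?_⟩⟩, rfl, rfl, ?_⟩
      · simp [hj]
      · simp [hj]
      · simp [hidx, hpar v hv]
    · have hidx : TwoDownIndex G C u i :=
        ⟨hi, (hbehind v hv).1, fun w hw => ⟨(hbehind w hw).2.2, (hbehind w hw).2.1⟩⟩
      refine ⟨.syncTwoDown, ⟨(C u).d, (C u).err,
        fun j => if TwoDownIndex G C u j then (C v).c j else (C u).c j,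
        fun j => if TwoDownIndex G C u j then .down else (C u).b j⟩,
        ⟨hwd, by omega, by omega, i, hidx⟩,
        ⟨rfl, rfl, v, hv, fun j => ⟨fun hj => ?_, fun hj => ?_⟩⟩, rfl, rfl, ?_⟩
      · simp [hj]
      · simp [hj]
      · simp [hidx, hpar v hv]

/-- The clock `i` of an isolated leader `x` can be copied to the whole ball of radius `i` around
`x`, layer after layer. -/
lemma down_wave [Finite V] (hk : 2 < k) {x : V} {i : Clock k} {δ : V → ℕ}
    (hx : Isolated G δ x i.1) :
    ∀ (n : ℕ) (C : Config V k), dval C = δ → Calm G C →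
      {u ∈ Ball G δ x i.1 | (C u).c i ≠ (C x).c i}.ncard = n →
      Drops ver G (leaders C).ncard C ∨ ∃ C', Evolves ver G (Ball G δ x i.1) C C' ∧
        ∀ u ∈ Ball G δ x i.1, (C' u).c i = (C x).c i := by
  classical
  intro n
  induction n using Nat.strong_induction_on with
  | _ n ih =>
  rintro C rfl hC hn
  have hik := i.2.2
  set S := {u ∈ Ball G (dval C) x i.1 | (C u).c i ≠ (C x).c i} with hS
  rcases S.eq_empty_or_nonempty with hempty | hne
  · refine Or.inr ⟨C, Evolves.refl hC, fun u hu => ?_⟩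
    by_contra h
    have : u ∈ S := ⟨hu, h⟩
    simp [hempty] at this
  · -- By minimality, the parents of `u` already have the clock of `x`.
    obtain ⟨u, ⟨huB, huc⟩, hmin⟩ := Set.exists_min_image S (dval C) (Set.toFinite S) hne
    by_cases hcoh : BranchCoherence G C u
    swap
    · exact Or.inl (hC.drops_of_not_coherent hk hcoh)
    have hux : u ≠ x := by rintro rfl; exact huc rfl
    have hu0 : dval C u ≠ 0 := fun h => hux (eq_of_mem_ball huB h)
    have hpB : ∀ v, Parent G C u v → v ∈ Ball G (dval C) x i.1 :=
      fun v hv => hx.parent_mem_ball hC.stable huB hik hv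
    obtain ⟨R, s, hg, hs, hsd, hse, hsc⟩ := exists_sync_down (ver := ver) hC (a := (C x).c i) hu0
      huB.1 hcoh huc (fun v hv => by
        by_contra h
        have h1 := hmin v ⟨hpB v hv, h⟩
        have h2 := hv.2
        omega) (fun h1 v w hv hw => by
        have h2 := hv.2
        have h3 := hw.2
        rw [eq_of_mem_ball (hpB v hv) (by omega), eq_of_mem_ball (hpB w hw) (by omega)])
    have hu1 := huB.1
    rcases hC.drops_or_evolves hk huB (by omega) hg hs hsd hse (fun h => absurd h hu0) with h | h
    · exact Or.inl h
    · have hxx : (Function.update C u s x).c i = (C x).c i := by simp [hux.symm]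
      have hlt : {v ∈ Ball G (dval C) x i.1 | (Function.update C u s v).c i ≠
          (Function.update C u s x).c i}.ncard < n := by
        rw [← hn]
        refine Set.ncard_lt_ncard ⟨?_, fun hsub => ?_⟩
        · rintro v ⟨hvB, hv⟩
          rw [hxx] at hv
          refine ⟨hvB, ?_⟩
          by_cases hvu : v = u
          · subst hvu; exact huc
          · simpa [hvu] using hv
        · have := (hsub ⟨huB, huc⟩).2
          rw [hxx] at this
          simp [hsc] at this
      rcases ih _ hlt _ h.dval_eq h.calm rfl with h' | ⟨C', h', hc'⟩
      · exact Or.inl (h.drops h')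
      · exact Or.inr ⟨C', h.trans h', fun v hv => (hc' v hv).trans hxx⟩

/-- In the amended algorithm, the arrows of index `i` can be turned up in the whole ball of an
isolated leader, from the outermost layer inwards, once the clocks `i` agree there. -/
lemma up_wave [Finite V] (hk : 2 < k) (hver : ver = .amended) {x : V} {i : Clock k} {δ : V → ℕ}
    (hx : Isolated G δ x i.1) {a : ZMod 4} :
    ∀ (n : ℕ) (C : Config V k), dval C = δ → Calm G C →
      (∀ u ∈ Ball G δ x i.1, (C u).c i = a) →
      {u ∈ Ball G δ x i.1 | u ≠ x ∧ (C u).b i ≠ .up}.ncard = n →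
      Drops ver G (leaders C).ncard C ∨ ∃ C', Evolves ver G (Ball G δ x i.1) C C' ∧
        (∀ u ∈ Ball G δ x i.1, (C' u).c i = a) ∧
        ∀ u ∈ Ball G δ x i.1, u ≠ x → (C' u).b i = .up := by
  classical
  intro n
  induction n using Nat.strong_induction_on with
  | _ n ih =>
  rintro C rfl hC ha hn
  have hik := i.2.2
  set S := {u ∈ Ball G (dval C) x i.1 | u ≠ x ∧ (C u).b i ≠ .up} with hS
  rcases S.eq_empty_or_nonempty with hempty | hne
  · refine Or.inr ⟨C, Evolves.refl hC, ha, fun u hu hux => ?_⟩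
    by_contra h
    have : u ∈ S := ⟨hu, hux, h⟩
    simp [hempty] at this
  · -- By maximality, the arrows of the children of `u` already point up.
    obtain ⟨u, ⟨huB, hux, hub⟩, hmax⟩ := Set.exists_max_image S (dval C) (Set.toFinite S) hne
    have hb : (C u).b i = .down := by
      cases h : (C u).b i with
      | up => exact absurd h hub
      | down => rfl
    by_cases hcoh : BranchCoherence G C u
    swap
    · exact Or.inl (hC.drops_of_not_coherent hk hcoh)
    have hu0 : dval C u ≠ 0 := fun h => hux (eq_of_mem_ball huB h)
    have hu1 := huB.1
    have hwd : WellDefined G C u := hC.wellDefined (by omega)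
    obtain ⟨v, hv⟩ := hwd.2.2 (by omega)
    have hpB : ∀ v, Parent G C u v → v ∈ Ball G (dval C) x i.1 :=
      fun v hv => hx.parent_mem_ball hC.stable huB hik hv
    obtain ⟨R, s, hg, hs, hsd, hse, hsc, hsb⟩ : ∃ R s, guard ver G C u R ∧ command ver G C u R s ∧
        s.d = (C u).d ∧ s.err = (C u).err ∧ s.c i = a ∧ s.b i = .up := by
      by_cases hend : i.1 = dval C u
      · refine ⟨.syncEndOfChain, ⟨(C u).d, (C u).err,
          fun j => if j.1 = dval C u then (C v).c j else (C u).c j,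
          fun j => if j.1 = dval C u then .up else (C u).b j⟩,
          ⟨hwd, i, hend, Or.inr ⟨hver, hb, fun w hw => ⟨?_, ?_⟩⟩⟩,
          ⟨rfl, rfl, v, hv, fun j => ⟨fun hj => ?_, fun hj => ?_⟩⟩, rfl, rfl, ?_, ?_⟩
        · rw [ha u huB, ha w (hpB w hw)]
        · rcases hcoh.parent huB.1 hw with h | h
          · exact h.2 hb
          · exact h.2.1
        · simp [hj]
        · simp [hj]
        · simp [hend, ha v (hpB v hv)]
        · simp [hend]
      · have hidx : UpIndex G C u i := by
          refine ⟨by omega, hb, fun w hw => ?_⟩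
          have hwB := child_mem_ball huB (by omega) hw
          refine ⟨by rw [ha u huB, ha w hwB], ?_⟩
          have h2 := hw.2
          by_contra h
          have hwx : w ≠ x := by
            rintro rfl
            have := hx.leader
            omega
          have := hmax w ⟨hwB, hwx, h⟩
          omega
        refine ⟨.syncUp, ⟨(C u).d, (C u).err, (C u).c,
          fun j => if UpIndex G C u j then .up else (C u).b j⟩,
          ⟨hwd, by omega, by omega, i, hidx⟩,
          ⟨rfl, rfl, rfl, fun j => ⟨fun hj => ?_, fun hj => ?_⟩⟩, rfl, rfl, ha u huB, ?_⟩
        · simp [hj]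
        · simp [hj]
        · simp [hidx]
    rcases hC.drops_or_evolves hk huB (by omega) hg hs hsd hse (fun h => absurd h hu0) with h | h
    · exact Or.inl h
    · have hlt : {w ∈ Ball G (dval C) x i.1 | w ≠ x ∧
          (Function.update C u s w).b i ≠ .up}.ncard < n := by
        rw [← hn]
        refine Set.ncard_lt_ncard ⟨?_, fun hsub => ?_⟩
        · rintro w ⟨hwB, hwx, hw⟩
          refine ⟨hwB, hwx, ?_⟩
          by_cases hwu : w = u
          · subst hwu; exact hub
          · simpa [hwu] using hw
        · have := (hsub ⟨huB, hux, hub⟩).2.2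
          simp [hsb] at this
      have ha' : ∀ w ∈ Ball G (dval C) x i.1, (Function.update C u s w).c i = a := by
        intro w hw
        by_cases hwu : w = u
        · subst hwu; simpa using hsc
        · simpa [hwu] using ha w hw
      rcases ih _ hlt _ h.dval_eq h.calm ha' rfl with h' | ⟨C', h', hc'⟩
      · exact Or.inl (h.drops h')
      · exact Or.inr ⟨C', h.trans h', hc'⟩

/-- If the clocks `i` agree in the ball of radius `i` around an isolated leader, they can all be
incremented. In the displayed algorithm the leader need not wait for the arrows of its children to
turn up: if one of them points down, the increment breaks branch coherence. -/
lemma exists_increment [Finite V] (hk : 2 < k) {x : V} {i : Clock k} {C : Config V k}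
    (hC : Calm G C) (hx : Isolated G (dval C) x i.1) {a : ZMod 4}
    (ha : ∀ u ∈ Ball G (dval C) x i.1, (C u).c i = a) :
    Drops ver G (leaders C).ncard C ∨ ∃ C', Evolves ver G (Ball G (dval C) x i.1) C C' ∧
      ∀ u ∈ Ball G (dval C) x i.1, (C' u).c i = a + 1 := by
  classical
  have hik := i.2.2
  obtain h | ⟨C₁, h₁, ha₁, hup₁⟩ : Drops ver G (leaders C).ncard C ∨
      ∃ C₁, Evolves ver G (Ball G (dval C) x i.1) C C₁ ∧
        (∀ u ∈ Ball G (dval C) x i.1, (C₁ u).c i = a) ∧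
        (ver = .amended → ∀ u ∈ Ball G (dval C) x i.1, u ≠ x → (C₁ u).b i = .up) := by
    by_cases hver : ver = .amended
    · refine (up_wave hk hver hx _ C rfl hC ha rfl).imp_right ?_
      rintro ⟨C₁, h, h', h''⟩
      exact ⟨C₁, h, h', fun _ => h''⟩
    · exact Or.inr ⟨C, Evolves.refl hC, ha, fun h => absurd h hver⟩
  · exact Or.inl h
  have hd₁ := h₁.dval_eq
  rw [← hd₁] at hx ha₁ hup₁ h₁ ⊢
  have hwd : WellDefined G C₁ x := h₁.calm.wellDefined (by rw [hx.leader]; omega)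
  have hidx : IncrIndex ver G C₁ x i := by
    intro v hv
    have hv1 := hx.dval_of_adj h₁.calm.stable i.2.1 hv
    have hvB : v ∈ Ball G (dval C₁) x i.1 := by
      refine ⟨by rw [hv1]; exact i.2.1, ?_⟩
      rw [hv1]
      exact_mod_cast (SimpleGraph.edist_eq_one_iff_adj.2 hv).le
    exact ⟨hv1, by rw [ha₁ x hx.mem_ball, ha₁ v hvB, sub_self], fun h => hup₁ h v hvB hv.ne'⟩
  let s : State k := ⟨(C₁ x).d, (C₁ x).err,
    fun j => if IncrIndex ver G C₁ x j then (C₁ x).c j + 1 else (C₁ x).c j, (C₁ x).b⟩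
  have hg : guard ver G C₁ x .incrLeader := ⟨hwd, hx.leader, i, hidx⟩
  have hs : command ver G C₁ x .incrLeader s :=
    ⟨rfl, rfl, rfl, fun j => ⟨fun hj => by simp [s, hj], fun hj => by simp [s, hj]⟩⟩
  have hsc : s.c i = a + 1 := by simp [s, hidx, ha₁ x hx.mem_ball]
  rcases h₁.calm.drops_or_evolves hk hx.mem_ball (by rw [hx.leader]; omega) hg hs rfl rfl
    (fun _ => rfl) with h | h₂
  · exact Or.inl (h₁.drops h)
  · rcases down_wave hk hx _ _ h₂.dval_eq h₂.calm rfl with h | ⟨C₃, h₃, hc₃⟩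
    · exact Or.inl (h₁.drops (h₂.drops h))
    · refine Or.inr ⟨C₃, h₁.trans (h₂.trans h₃), fun u hu => ?_⟩
      rw [hc₃ u hu]
      simpa using hsc

/-- The clock `i` can be given any value in the ball of radius `i` around an isolated leader. -/
lemma exists_set_clock [Finite V] (hk : 2 < k) {x : V} {i : Clock k} {C : Config V k}
    (hC : Calm G C) (hx : Isolated G (dval C) x i.1) (a : ZMod 4) :
    Drops ver G (leaders C).ncard C ∨ ∃ C', Evolves ver G (Ball G (dval C) x i.1) C C' ∧
      ∀ u ∈ Ball G (dval C) x i.1, (C' u).c i = a := by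
  have key : ∀ n : ℕ, Drops ver G (leaders C).ncard C ∨
      ∃ C', Evolves ver G (Ball G (dval C) x i.1) C C' ∧
        ∀ u ∈ Ball G (dval C) x i.1, (C' u).c i = (C x).c i + n := by
    intro n
    induction n with
    | zero => simpa using down_wave hk hx _ C rfl hC rfl
    | succ n ih =>
      rcases ih with h | ⟨C₁, h₁, ha₁⟩
      · exact Or.inl h
      · rw [← h₁.dval_eq] at hx ha₁ h₁ ⊢
        rcases exists_increment (ver := ver) hk h₁.calm hx ha₁ with h | ⟨C₂, h₂, ha₂⟩
        · exact Or.inl (h₁.drops h)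
        · refine Or.inr ⟨C₂, h₁.trans h₂, fun u hu => ?_⟩
          rw [ha₂ u hu]
          push_cast
          ring
  have := key (a - (C x).c i).val
  simpa using this

/-! ### Collisions -/

/-- On a shortest path between two leaders at minimal distance, the `d`-value of a node in the
half of `x` is its distance to `x`. -/
lemma Stable.dval_eq_of_closest {C : Config V k} (hC : Stable G C) {x w u : V} {m n : ℕ}
    (hx : dval C x = 0) (hxw : x ≠ w)
    (hmin : ∀ y z, dval C y = 0 → dval C z = 0 → y ≠ z → ((m + n : ℕ) : ℕ∞) ≤ G.edist y z)
    (hw : dval C w = 0) (hmn : m ≤ n) (hmk : m < k) (hxu : G.edist x u ≤ (m : ℕ∞))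
    (huw : G.edist u w ≤ (n : ℕ∞)) : dval C u = m := by
  have hle : dval C u ≤ m := hC.dval_le (by rwa [SimpleGraph.edist_comm]) hx
  by_contra hne
  obtain ⟨z, hz, huz⟩ := hC.exists_leader (u := u) (by omega)
  have hclose : ∀ y l, dval C y = 0 → G.edist y z ≤ ((l : ℕ) : ℕ∞) → l < m + n → y = z := by
    intro y l hy hyz hl
    by_contra h
    have := (hmin y z hy hz h).trans hyz
    have : m + n ≤ l := by exact_mod_cast this
    omega
  rw [SimpleGraph.edist_comm] at huw
  exact hxw ((hclose x _ hx (edist_le_add hxu huz) (by omega)).trans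
    (hclose w _ hw (edist_le_add huw huz) (by omega)).symm)

/-- Two leaders at distance less than `k` allow to remove one. If `D` is the least distance
between two leaders, the balls of radius `(D - 1) / 2` around two leaders at distance `D` do not
interact, so that their clocks of that index can be brought to differ by `2`, which is then
noticed by a node in the middle between them. -/
lemma Calm.drops_of_close [Finite V] (hk : 2 < k) {C : Config V k} (hC : Calm G C) {x w : V}
    (hx : dval C x = 0) (hw : dval C w = 0) (hxw : x ≠ w) (hd : G.edist x w < (k : ℕ∞)) :
    Drops ver G (leaders C).ncard C := by
  classical
  obtain ⟨⟨x, w⟩, ⟨hx, hw, hxw, hd⟩, hmin⟩ := Set.exists_min_image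
    {p : V × V | dval C p.1 = 0 ∧ dval C p.2 = 0 ∧ p.1 ≠ p.2 ∧ G.edist p.1 p.2 < (k : ℕ∞)}
    (fun p => G.edist p.1 p.2) (Set.toFinite _) ⟨(x, w), hx, hw, hxw, hd⟩
  simp only at hx hw hxw hd hmin
  obtain ⟨p, hp⟩ := SimpleGraph.exists_walk_of_edist_ne_top hd.ne_top
  have hDk : p.length < k := by rw [← hp] at hd; exact_mod_cast hd
  have hmin' : ∀ y z, dval C y = 0 → dval C z = 0 → y ≠ z →
      ((p.length : ℕ) : ℕ∞) ≤ G.edist y z := by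
    intro y z hy hz hyz
    rcases lt_or_ge (G.edist y z) (k : ℕ∞) with h | h
    · rw [hp]
      exact hmin (y, z) ⟨hy, hz, hyz, h⟩
    · exact le_trans (by exact_mod_cast hDk.le) h
  have hto : ∀ t, G.edist x (p.getVert t) ≤ (t : ℕ∞) := fun t =>
    (p.take t).edist_le.trans (by exact_mod_cast (by simp))
  have hfrom : ∀ t, G.edist (p.getVert t) w ≤ ((p.length - t : ℕ) : ℕ∞) := fun t =>
    (p.drop t).edist_le.trans (by exact_mod_cast (by simp))
  have hdl : ∀ t, 2 * t ≤ p.length → dval C (p.getVert t) = t := by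
    intro t ht
    refine hC.stable.dval_eq_of_closest (m := t) (n := p.length - t) hx hxw ?_ hw
      (by omega) (by omega) (hto t) (hfrom t)
    rwa [show t + (p.length - t) = p.length by omega]
  have hdr : ∀ t, t ≤ p.length → p.length ≤ 2 * t →
      dval C (p.getVert t) = p.length - t := by
    intro t ht ht'
    refine hC.stable.dval_eq_of_closest (m := p.length - t) (n := t) hw hxw.symm ?_ hx
      (by omega) (by omega) ?_ ?_
    · rwa [show p.length - t + t = p.length by omega]
    · rw [SimpleGraph.edist_comm]; exact hfrom t
    · rw [SimpleGraph.edist_comm]; exact hto t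
  have hpos : 0 < p.length := by
    rcases Nat.eq_zero_or_pos p.length with h | h
    · exact absurd (SimpleGraph.Walk.eq_of_length_eq_zero h) hxw
    · exact h
  -- The two nodes whose clocks are compared, and the node that compares them.
  obtain ⟨i, t, hi, hu, hv, hv'⟩ : ∃ i t, (2 * i + 1 = p.length ∨ 2 * i + 2 = p.length) ∧
      2 * t ≤ p.length ∧
      InClosedNbhd G (p.getVert t) (p.getVert i) ∧
      InClosedNbhd G (p.getVert t) (p.getVert (p.length - i)) := by
    rcases Nat.even_or_odd' p.length with ⟨j, hj | hj⟩
    · have h1 := p.adj_getVert_succ (i := j - 1) (by omega)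
      have h2 := p.adj_getVert_succ (i := j) (by omega)
      rw [show j - 1 + 1 = j by omega] at h1
      refine ⟨j - 1, j, by omega, by omega, Or.inr h1.symm, Or.inr ?_⟩
      rwa [show p.length - (j - 1) = j + 1 by omega]
    · have h2 := p.adj_getVert_succ (i := j) (by omega)
      refine ⟨j, j, by omega, by omega, Or.inl rfl, Or.inr ?_⟩
      rwa [show p.length - j = j + 1 by omega]
  have hdu := hdl t hu
  have hdv := hdl i (by omega)
  have hdv' := hdr (p.length - i) (by omega) (by omega)
  rw [show p.length - (p.length - i) = i by omega] at hdv'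
  rcases Nat.eq_zero_or_pos i with rfl | hi0
  · refine hC.drops_of_alarm hk (u := p.getVert t) (R := .twoHeads) (Or.inl rfl)
      ⟨hC.err _, _, _, hv, hv', ?_, hdv, hdv'⟩ (by omega)
    simpa using hxw
  · let c : Clock k := ⟨i, hi0, by omega⟩
    have hiso : Isolated G (dval C) x c.1 :=
      ⟨hx, fun z hz hzx => le_trans (by
        have : 2 * i + 1 ≤ p.length := by omega
        exact_mod_cast this) (hmin' x z hx hz hzx.symm)⟩
    have hvB : p.getVert i ∈ Ball G (dval C) x c.1 := by
      refine ⟨hdv.le, ?_⟩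
      rw [hdv]
      exact hto i
    have hv'B : p.getVert (p.length - i) ∉ Ball G (dval C) x c.1 := by
      rintro ⟨-, h⟩
      have h1 := hfrom (p.length - i)
      rw [hdv'] at h
      rw [show p.length - (p.length - i) = i by omega] at h1
      exact hxw (hiso.eq hw (edist_le_add h h1) (by simp only [c]; omega)).symm
    rcases exists_set_clock (ver := ver) hk hC hiso ((C (p.getVert (p.length - i))).c c + 2) with
      h | ⟨C', h, hc⟩
    · exact h
    · refine h.drops (h.calm.drops_of_alarm hk (u := p.getVert t) (R := .remoteCollision)
        (Or.inr (Or.inr rfl)) ⟨h.calm.err _, ?_, _, _, hv, hv', c, ?_, ?_, ?_⟩ ?_)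
      · rw [h.dval_eq, hdu]; omega
      · rw [h.dval_eq, hdv]
      · rw [h.dval_eq, hdv']
      · rw [hc _ hvB, h.outside _ hv'B]
        ring
      · rw [h.dval_eq, hdu]; omega

/-! ### New leaders -/

/-- A calm and coherent configuration whose leaders are pairwise at distance at least `k`. It is
legitimate unless some node can become a leader. -/
structure Tidy (G : SimpleGraph V) (C : Config V k) : Prop where
  calm : Calm G C
  coherent : ∀ u, BranchCoherence G C u
  far : ∀ u ∈ leaders C, ∀ v ∈ leaders C, u ≠ v → (k : ℕ∞) ≤ G.edist u v

lemma exists_tidy [Finite V] (hk : 2 < k) :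
    ∀ (n : ℕ) (C : Config V k), (leaders C).ncard = n → ∃ C', Reaches ver G C C' ∧ Tidy G C' := by
  intro n
  induction n using Nat.strong_induction_on with
  | _ n ih =>
  intro C hn
  have hdrop : ∀ {C₀ : Config V k}, Drops ver G (leaders C).ncard C₀ →
      ∃ C', Reaches ver G C₀ C' ∧ Tidy G C' := by
    rintro C₀ ⟨C₁, hr, hlt⟩
    obtain ⟨C₂, hr', ht⟩ := ih _ (hn ▸ hlt) C₁ rfl
    exact ⟨C₂, Relation.ReflTransGen.trans hr hr', ht⟩
  rcases drops_or_exists_calm (ver := ver) (G := G) hk C with h | ⟨C₁, hr, hl, hC₁⟩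
  · exact hdrop h
  by_cases hD : Drops ver G (leaders C₁).ncard C₁
  · rw [hl] at hD
    exact hdrop (hD.of_reaches hr)
  · refine ⟨C₁, hr, hC₁, fun u => ?_, fun u hu v hv huv => ?_⟩
    · by_contra h
      exact hD (hC₁.drops_of_not_coherent hk h)
    · by_contra h
      exact hD (hC₁.drops_of_close hk hu hv huv (not_le.1 h))

/-- What is known while the distances are updated after `x` has become a leader in the
configuration `C`: the nodes with `d`-value less than `⌊k/2⌋` in `C` have not moved, and the other
ones with `d`-value less than `⌊k/2⌋` are close to `x` and carry its clocks and arrows. -/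
structure Expands (G : SimpleGraph V) (C : Config V k) (x : V) (C' : Config V k) : Prop where
  old : ∀ v, dval C v < k / 2 → C' v = C v
  new : ∀ v, k / 2 ≤ dval C v → dval C' v < k / 2 → G.edist x v ≤ (dval C' v : ℕ∞) ∧
    ∀ i : Clock k, dval C' v ≤ i.1 → (C' v).c i = 0 ∧ (C' v).b i = .down
  err : ∀ v, (C' v).err = false
  zero : ∀ v, dval C' v = 0 ↔ v = x ∨ dval C v = 0

lemma Expands.dval_old {C C' : Config V k} {x v : V} (h : Expands G C x C')
    (hv : dval C v < k / 2) : dval C' v = dval C v := by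
  simp only [dval, h.old v hv]

/-- The old balls and the new one are not adjacent. -/
lemma Expands.old_of_adj {C C' : Config V k} {x v w : V} (h : Expands G C x C')
    (hC : Stable G C) (hx : ∀ z, dval C z = 0 → (k : ℕ∞) ≤ G.edist x z)
    (hv : dval C v < k / 2) (hw : dval C' w < k / 2) (hvw : G.Adj v w) : dval C w < k / 2 := by
  by_contra hw'
  have hxw := (h.new w (not_lt.1 hw') hw).1
  obtain ⟨z, hz, hvz⟩ := hC.exists_leader (u := v) (by omega)
  have := (hx z hz).trans (edist_le_add (edist_le_add_one hvw.symm hxw) hvz)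
  have : k ≤ dval C' w + 1 + dval C v := by exact_mod_cast this
  omega

lemma Expands.round (hk : 2 < k) {C C' C'' : Config V k} {x : V} (h : Expands G C x C')
    (hC : Stable G C) (hx : ∀ z, dval C z = 0 → (k : ℕ∞) ≤ G.edist x z)
    (hr : Round ver G C' C'') : Expands G C x C'' := by
  refine ⟨fun v hv => ?_, fun v hv hv' => ?_, fun v => ?_, fun v => ?_⟩
  · rw [← h.old v hv]
    refine (hr v).2 fun hg => hg.2 ?_
    have hd := h.dval_old hv
    have h0 : dval C v ≠ 0 := hd ▸ hg.1
    rw [hd]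
    apply le_antisymm
    · rw [le_newDist_iff]
      refine ⟨by omega, fun w hw => ?_⟩
      by_cases hw' : dval C' w < k / 2
      · rw [h.dval_old (h.old_of_adj hC hx hv hw' hw)]
        exact hC.le_of_adj hw
      · omega
    · obtain ⟨p, hp, hp'⟩ := hC.exists_parent h0 (by omega)
      have := newDist_le_of_adj (C := C') hp
      rw [h.dval_old (v := p) (by omega)] at this
      omega
  · by_cases hg : guard ver G C' v .updateDistance
    · obtain ⟨hd, -, hcopy⟩ := (hr v).1 hg
      change dval C'' v = _ at hd
      rw [← hd] at hcopy
      rcases hcopy with ⟨hK, -⟩ | ⟨-, p, hp, hp', hcopy⟩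
      · omega
      · have hpC : k / 2 ≤ dval C p := by
          by_contra hpC
          have h1 := h.dval_old (not_le.1 hpC)
          have h2 := hC.le_of_adj hp
          omega
        obtain ⟨hxp, hclean⟩ := h.new p hpC (by omega)
        refine ⟨?_, fun i hi => ?_⟩
        · rw [← hp']
          exact edist_le_add_one hp.symm hxp
        · rw [((hcopy i).1 hi).1, ((hcopy i).1 hi).2]
          exact hclean i (by omega)
    · have he := (hr v).2 hg
      have hd : dval C'' v = dval C' v := by simp only [dval, he]
      rw [hd] at hv' ⊢
      rw [he]
      exact h.new v hv hv'
  · by_cases hg : guard ver G C' v .updateDistance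
    · rw [((hr v).1 hg).2.1]
      exact h.err v
    · rw [(hr v).2 hg]
      exact h.err v
  · rw [hr.dval_eq_zero_iff hk]
    exact h.zero v

/-- Once the distances are stable again, the configuration is tidy again. -/
lemma Expands.tidy {C C' : Config V k} {x : V} (h : Expands G C x C')
    (hC : Tidy G C) (hx : ∀ z, dval C z = 0 → (k : ℕ∞) ≤ G.edist x z) (hC' : Stable G C') :
    Tidy G C' := by
  have hstab := hC.calm.stable
  refine ⟨⟨hC', h.err, fun v h0 i => ?_⟩, fun u => ?_, fun u hu v hv huv => ?_⟩
  · have := i.2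
    by_cases hv : dval C v < k / 2
    · rw [h.old v hv]
      exact hC.calm.down v (by rw [← h.dval_old hv, h0]) i
    · exact ((h.new v (not_lt.1 hv) (by omega)).2 i (by omega)).2
  · by_cases hK : k / 2 ≤ dval C' u
    · exact Or.inl hK
    · rw [not_le] at hK
      by_cases hu : dval C u < k / 2
      · have hdu := h.dval_old hu
        have hup : ∀ i : Clock k, BranchCoherenceUp G C u i → BranchCoherenceUp G C' u i := by
          intro i hi v hv
          have h2 := hv.2
          have hvK := h.old_of_adj hstab hx hu (by omega) hv.1
          have hdv := h.dval_old hvK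
          have := hi v ⟨hv.1, by omega⟩
          rwa [h.old u hu, h.old v hvK]
        have hdown : ∀ i : Clock k, dval C' u < i.1 → BranchCoherenceDown G C u i →
            BranchCoherenceDown G C' u i := by
          intro i hui hi v hv
          have h2 := hv.2
          have h3 := i.2.2
          have hvK := h.old_of_adj hstab hx hu (by omega) hv.1
          have hdv := h.dval_old hvK
          have := hi v ⟨hv.1, by omega⟩
          rwa [h.old u hu, h.old v hvK]
        rcases hC.coherent u with hK' | ⟨h1, h2⟩
        · omega
        · refine Or.inr ⟨fun i hi => hup i (h1 i (by omega)), fun i hi => ?_⟩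
          have := h2 i (by omega)
          exact ⟨hup i this.1, hdown i hi this.2⟩
      · have hnew : ∀ v, G.Adj u v → dval C' v < k / 2 → k / 2 ≤ dval C v := by
          intro v hv hvK
          by_contra hv'
          exact hu (h.old_of_adj hstab hx (not_le.1 hv') hK hv.symm)
        have hcu := (h.new u (not_lt.1 hu) hK).2
        have hup : ∀ i : Clock k, dval C' u ≤ i.1 → BranchCoherenceUp G C' u i := by
          intro i hi v hv
          have h2 := hv.2
          have hcv := (h.new v (hnew v hv.1 (by omega)) (by omega)).2 i (by omega)
          simp [hcu i hi, hcv]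
        refine Or.inr ⟨fun i hi => hup i hi.ge, fun i hi => ⟨hup i hi.le, fun v hv => ?_⟩⟩
        have h2 := hv.2
        have h3 := i.2.2
        have hcv := (h.new v (hnew v hv.1 (by omega)) (by omega)).2 i (by omega)
        simp [hcu i hi.le, hcv]
  · rcases (h.zero u).1 hu with rfl | hu'
    · rcases (h.zero v).1 hv with rfl | hv'
      · exact absurd rfl huv
      · exact hx v hv'
    · rcases (h.zero v).1 hv with rfl | hv'
      · rw [SimpleGraph.edist_comm]
        exact hx u hu'
      · exact hC.far u hu' v hv' huv

/-- From a tidy configuration, a node without parent and all of whose neighbors have `d`-value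
`k - 1` can become a leader, and the configuration can be made tidy again. -/
lemma Tidy.exists_more_leaders [Finite V] (hk : 2 < k) {C : Config V k} (hC : Tidy G C) {x : V}
    (hx : dval C x = k - 1) (hadj : ∀ v, G.Adj x v → dval C v = k - 1) :
    ∃ C', Reaches ver G C C' ∧ Tidy G C' ∧ (leaders C).ncard < (leaders C').ncard := by
  classical
  have hnbhd : ∀ v, InClosedNbhd G x v → dval C v = k - 1 := by
    rintro v (rfl | hv)
    · exact hx
    · exact hadj v hv
  have hfar : ∀ z, dval C z = 0 → (k : ℕ∞) ≤ G.edist x z := by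
    intro z hz
    -- A shorter walk to a leader would pass through a neighbor with `d`-value below `k - 1`.
    by_contra hlt
    obtain ⟨p, hp⟩ := SimpleGraph.exists_walk_of_edist_ne_top (not_le.1 hlt).ne_top
    have hpk : p.length < k := by
      rw [← hp, not_le] at hlt
      exact_mod_cast hlt
    cases p with
    | nil => omega
    | cons hv q =>
      have h1 := hC.calm.stable.dval_le_length q hz
      have h2 := hadj _ hv
      simp only [SimpleGraph.Walk.length_cons] at hpk
      omega
  let s : State k := ⟨⟨0, by omega⟩, false, fun _ => 0, fun _ => .down⟩
  have hel : Eligible ver G C x .becomeLeader := by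
    refine ⟨⟨hC.calm.err x, hx, hadj⟩, fun R hR hg => ?_⟩
    rcases Rule.eq_of_priority_lt hR with rfl | rfl | rfl | rfl | rfl
    · exact hC.calm.stable.not_updateDistance x hg
    · have := hg.2.1
      omega
    · obtain ⟨-, v, -, hv, -, -, h0, -⟩ := hg
      have := hnbhd v hv
      omega
    · exact hg.2 (hC.coherent x)
    · have := hg.2.1
      omega
  have hstep : Step ver G C (Function.update C x s) :=
    Step.update hel ⟨rfl, (hC.calm.err x).symm, fun _ => ⟨rfl, rfl⟩⟩
  have hexp : Expands G C x (Function.update C x s) := by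
    refine ⟨fun v hv => ?_, fun v hv hv' => ?_, fun v => ?_, fun v => ?_⟩
    · have : v ≠ x := by rintro rfl; omega
      simp [this]
    · by_cases hvx : v = x
      · subst hvx
        simp [s]
      · have : dval (Function.update C x s) v = dval C v := by simp [dval, hvx]
        omega
    · by_cases hvx : v = x
      · subst hvx; simp [s]
      · simpa [hvx] using hC.calm.err v
    · by_cases hvx : v = x
      · subst hvx; simp [s, dval]
      · simp [dval, hvx]
  obtain ⟨C', hr, hs⟩ := exists_stable (ver := ver) (G := G) hk (Function.update C x s)
  have hexp' : Expands G C x C' := by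
    clear hs
    induction hr with
    | refl => exact hexp
    | tail _ hr ih => exact ih.round hk hC.calm.stable hfar hr
  refine ⟨C', Relation.ReflTransGen.head hstep (reaches_of_rounds hr), hexp'.tidy hC hfar hs,
    Set.ncard_lt_ncard ⟨fun v hv => (hexp'.zero v).2 (Or.inr hv), fun hsub => ?_⟩⟩
  have : dval C x = 0 := hsub ((hexp'.zero x).2 (Or.inl rfl))
  omega

/-! ### Legitimate configurations -/

lemma Tidy.exists_legitimate [Finite V] (hk : 2 < k) :
    ∀ (n : ℕ) (C : Config V k), Nat.card V - (leaders C).ncard = n → Tidy G C →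
      ∃ C', Reaches ver G C C' ∧ Legitimate G C' := by
  intro n
  induction n using Nat.strong_induction_on with
  | _ n ih =>
  intro C hn hC
  by_cases hex : ∃ x, dval C x = k - 1 ∧ ∀ v, G.Adj x v → dval C v = k - 1
  · obtain ⟨x, hx, hadj⟩ := hex
    obtain ⟨C₁, hr, hC₁, hlt⟩ := hC.exists_more_leaders (ver := ver) hk hx hadj
    have hle := Set.ncard_le_card (leaders C₁)
    obtain ⟨C₂, hr', hC₂⟩ := ih _ (by omega) C₁ rfl hC₁
    exact ⟨C₂, Relation.ReflTransGen.trans hr hr', hC₂⟩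
  · push Not at hex
    have hst := hC.calm.stable
    refine ⟨C, Relation.ReflTransGen.refl, fun u => ⟨⟨hC.calm.err u,
      fun v hv => ⟨hst.le_of_adj hv, hst.le_of_adj hv.symm⟩, fun h0 => ?_⟩, hC.calm.down u,
      hC.coherent u⟩, hC.far⟩
    have hlt := dval_lt C u
    by_cases hu : dval C u = k - 1
    · obtain ⟨v, hv, hv'⟩ := hex u hu
      have h1 := hst.le_of_adj hv
      have h2 := dval_lt C v
      exact ⟨v, hv, by omega⟩
    · exact hst.exists_parent (by omega) (by omega)

lemma exists_legitimate [Finite V] (hk : 2 < k) (C : Config V k) :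
    ∃ C', Reaches ver G C C' ∧ Legitimate G C' := by
  obtain ⟨C₁, hr, hC₁⟩ := exists_tidy (ver := ver) (G := G) hk _ C rfl
  obtain ⟨C₂, hr', hC₂⟩ := Tidy.exists_legitimate (ver := ver) hk _ C₁ rfl hC₁
  exact ⟨C₂, Relation.ReflTransGen.trans hr hr', hC₂⟩

lemma Legitimate.isRulingSet {C : Config V k} (hC : Legitimate G C) :
    IsRulingSet G k (k - 1) (leaders C) := by
  refine ⟨hC.2, fun u => ?_⟩
  obtain ⟨z, hz, huz⟩ := exists_leader_of_parents (G := G) (C := C) _ u rfl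
    fun v h0 _ => (hC.1 v).1.2.2 (by omega)
  have := dval_lt C u
  refine ⟨z, hz, huz.trans ?_⟩
  exact_mod_cast (by omega : dval C u ≤ k - 1)

/-! ### The Gouda daemon -/

instance : Finite Arrow :=
  Finite.of_injective (fun a : Arrow => match a with | .up => true | .down => false) (by
    rintro (_ | _) (_ | _) h <;> simp at h ⊢)

instance : Finite (Clock k) :=
  Finite.of_injective (fun i : Clock k => (⟨i.1, i.2.2⟩ : Fin (k / 2))) fun i j h => by
    simpa [Subtype.ext_iff] using h

instance : Finite (State k) :=
  Finite.of_injective (fun s : State k => (s.d, s.err, s.c, s.b)) fun s t h => by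
    simp only [Prod.mk.injEq] at h
    exact State.ext h.1 h.2.1 h.2.2.1 h.2.2.2

lemma IsGouda.frequently_of_reaches {σ : ℕ → Config V k} (hσ : IsGouda ver G σ)
    {C C' : Config V k} (h : Reaches ver G C C') (hC : ∃ᶠ n in Filter.atTop, σ n = C) :
    ∃ᶠ n in Filter.atTop, σ n = C' := by
  induction h with
  | refl => exact hC
  | tail _ h ih => exact hσ _ _ h ih

lemma exists_frequently_eq {α : Type*} [Finite α] (σ : ℕ → α) :
    ∃ a, ∃ᶠ n in Filter.atTop, σ n = a := by
  by_contra! h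
  obtain ⟨n, hn⟩ := (Filter.eventually_all.2 h).exists
  exact hn (σ n) rfl

end RulingSet

theorem mainTheorem1 {V : Type*} [Finite V] (G : SimpleGraph V) (k : ℕ) (hk : 2 < k)
    (ver : RulingSet.Version) :
    (∀ σ : ℕ → RulingSet.Config V k,
        RulingSet.IsExecution ver G σ → RulingSet.IsGouda ver G σ →
          ∃ n, RulingSet.Legitimate G (σ n)) ∧
      ∀ C : RulingSet.Config V k, RulingSet.Legitimate G C →
        RulingSet.IsRulingSet G k (k - 1) (RulingSet.leaders C) := by
  refine ⟨fun σ _ hσ => ?_, fun C hC => hC.isRulingSet⟩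
  obtain ⟨C, hC⟩ := RulingSet.exists_frequently_eq σ
  obtain ⟨C', hr, hC'⟩ := RulingSet.exists_legitimate (ver := ver) (G := G) hk C
  obtain ⟨n, hn⟩ := (hσ.frequently_of_reaches hr hC).exists
  exact ⟨n, hn ▸ hC'⟩
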